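/- All graphs are finite directed acyclic graphs (DAGs), possibly with parallel edges; $t(e)$ and $h(e)$ denote the tail and head of an edge $e$. Let $G=(V,E)$ be a DAG with a netflow vector $\mathbf a\in\mathbb Z^V$, $\mathbf a\neq 0$, and let $$\mathcal F_G(\mathbf a)=\Big\{F\in\mathbb R_{\ge 0}^E:\ \sum_{t(e)=i}F(e)-\sum_{h(e)=i}F(e)=\mathbf a_i\ \text{ for all } i\in V\Big\}$$ be its flow polytope; its dimension is that of its affine span, with $\dim\emptyset=-1$. A *source* (*sink*) is a vertex without incoming (outgoing) edges, an *internal* vertex is one that is neither a source nor a sink, and a *route* is a path from a source to a sink. *Conservationist framed DAGs.* The vector $\mathbf a$ is *conservationist* if $\mathbf a_i=1$ at every source, $\mathbf a_i<0$ at every sink and $\mathbf a_i=0$ at every internal vertex. A *framing* of such a $(G,\mathbf a)$ consists of a total order on the outgoing edges of each non-sink vertex, a total order on the incoming edges of each internal vertex, and a total order on the set of sources. *Framed augmentations.* For arbitrary $(G,\mathbf a)$, an *augmentation* $(\hat G,\hat{\mathbf a})$ of $(G,\mathbf a)$ has vertex set $V\sqcup V_X\sqcup V_Y$ and edge set $E\sqcup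 E_X\sqcup E_Y$, where $E_X$ consists of edges from $V_X$ to vertices $i\in V$ with $\mathbf a_i>0$, exactly $\mathbf a_i$ of them ending at each such $i$; $E_Y$ consists of edges from vertices $i\in V$ with $\mathbf a_i<0$ to $V_Y$, at least $1$ and at most $|\mathbf a_i|$ of them beginning at each such $i$; and each vertex of $V_X$ (of $V_Y$) is incident to exactly one edge of $E_X$ (of $E_Y$). The netflow $\hat{\mathbf a}$ is $0$ on $V$, is $1$ on $V_X$, and is a negative integer at each vertex of $V_Y$, with $\mathbf a_i=\sum_{y\in E_Y,\,t(y)=i}\hat{\mathbf a}_{h(y)}$ for every $i\in V$ with $\mathbf a_i<0$. A *framing* of $(\hat G,\hat{\mathbf a})$ consists of total orders on the outgoing and on the incoming edges, in $\hat G$, of each vertex of $V$, and a total order on $V_X$. *Layering-simplices.* Let $(H,\mathbf b)$ with a framing be either of these two kinds of data. For two distinct paths $p,q$ from a vertex $i$ to sinks, $p<_i^+q$ means that, after their longest common initial part, $p$ continues with a smaller edge than $q$ in the outgoing order. For two distinct paths from sources to $i$, $p<_i^-q$ means that, before their longest common final part, $p$ arrives by a smaller edge than $q$ in the incoming order. Two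 routes are *incompatible* if they share a vertex $i$ at which, up to exchanging them, the part of $p$ before $i$ is $<_i^-$ that of $q$ and the part of $q$ after $i$ is $<_i^+$ that of $p$; otherwise they are *compatible*. A *route-clique* is a set of pairwise compatible routes. A *layering* is a set $L$ of routes of $H$ of which exactly $\mathbf b_i$ begin at each source $i$ and exactly $|\mathbf b_j|$ end at each sink $j$; so $L$ has exactly one route $L_s$ beginning at each source $s$ with $\mathbf b_s=1$, and no others. For distinct layerings, $L<M$ means $L_s<_s^+M_s$, where $s$ is the greatest such source, in the order of the framing, with $L_s\ne M_s$; this is a total order. For a set $\mathcal S$ of layerings let $\mathrm{routes}(\mathcal S)=\bigcup_{L\in\mathcal S}L$. A (possibly empty) set $\mathcal L=\{L^1<\dots<L^m\}$ of layerings is a *layering-simplex* if 1. $\mathrm{routes}(\mathcal L)$ is a route-clique; 2. for every $i$, $L^i$ is the least layering $L$ with $L\subseteq\mathrm{routes}(\{L^i,\dots,L^m\})$; 3. for every $i$, some route of $L^i$ is not in $\mathrm{routes}(\{L^{i+1},\dots,L^m\})$. **Statement.** Let $G$ be a DAG with netflow vector $\mathbf a\ne 0$. (a) For every framed augmentation of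 $(G,\mathbf a)$, every inclusion-maximal layering-simplex has cardinality $\dim\mathcal F_G(\mathbf a)+1$. (b) If $\mathbf a$ is conservationist, then for every framing of $(G,\mathbf a)$, every inclusion-maximal layering-simplex has cardinality $\dim\mathcal F_G(\mathbf a)+1$. -/

import Mathlib

namespace FramedFlow

/-- A directed graph with vertex set `V` and edge set `E`; parallel edges are allowed. -/
structure DirGraph (V E : Type*) where
  /-- The vertex at which an edge begins. -/
  tail : E → V
  /-- The vertex at which an edge ends. -/
  head : E → V

namespace DirGraph

variable {V E : Type*}

/-- The list of consecutive edges `es` is a directed path from `u` to `v`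
(the empty list is the trivial path at a vertex). -/
def IsPath (G : DirGraph V E) : V → List E → V → Prop
  | u, [], v => u = v
  | u, e :: es, v => G.tail e = u ∧ IsPath G (G.head e) es v

/-- There are no oriented cycles: every closed directed path is trivial. -/
def Acyclic (G : DirGraph V E) : Prop :=
  ∀ (v : V) (es : List E), G.IsPath v es v → es = []

/-- A source is a vertex with no incoming edges. -/
def IsSource (G : DirGraph V E) (i : V) : Prop := ∀ e, G.head e ≠ i

/-- A sink is a vertex with no outgoing edges. -/
def IsSink (G : DirGraph V E) (i : V) : Prop := ∀ e, G.tail e ≠ i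

/-- An internal vertex is one that is neither a source nor a sink. -/
def IsInternal (G : DirGraph V E) (i : V) : Prop := ¬ G.IsSource i ∧ ¬ G.IsSink i

/-- The edges that leave the vertex `i`. -/
def outEdges (G : DirGraph V E) (i : V) : Set E := {e | G.tail e = i}

/-- The edges that enter the vertex `i`. -/
def inEdges (G : DirGraph V E) (i : V) : Set E := {e | G.head e = i}

/-- A route: a directed path from a source to a sink. -/
@[ext]
structure Route (G : DirGraph V E) where
  /-- The first vertex. -/
  start : V
  /-- The last vertex. -/
  finish : V
  /-- The edges, in the order in which they are traversed. -/
  edges : List E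
  isPath : G.IsPath start edges finish
  start_isSource : G.IsSource start
  finish_isSink : G.IsSink finish

open scoped Classical in
/-- The flow polytope of `(G, a)`: all nonnegative functions `F` on the edges whose net outflow
at every vertex `i` is `a i`. -/
def flowPolytope [Fintype E] (G : DirGraph V E) (a : V → ℤ) : Set (E → ℝ) :=
  {F | (∀ e, 0 ≤ F e) ∧
    ∀ i, ∑ e with G.tail e = i, F e - ∑ e with G.head e = i, F e = (a i : ℝ)}

/-- Every source has netflow `1`, every sink has negative netflow and every internal vertex has
netflow `0`. -/
structure IsConservationist (G : DirGraph V E) (a : V → ℤ) : Prop where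
  source : ∀ i, G.IsSource i → a i = 1
  sink : ∀ i, G.IsSink i → a i < 0
  internal : ∀ i, G.IsInternal i → a i = 0

end DirGraph

open scoped Classical in
/-- The dimension of a polytope: that of its affine span, and `-1` for the empty polytope. -/
noncomputable def polytopeDim {E : Type*} (P : Set (E → ℝ)) : ℤ :=
  if P = ∅ then -1 else (Module.finrank ℝ (vectorSpan ℝ P) : ℤ)

/-- The relation `r` restricts to a (strict) total order on the set `s`. -/
structure TotalOrderOn {α : Type*} (r : α → α → Prop) (s : Set α) : Prop where
  irrefl : ∀ x ∈ s, ¬ r x x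
  trans : ∀ x ∈ s, ∀ y ∈ s, ∀ z ∈ s, r x y → r y z → r x z
  total : ∀ x ∈ s, ∀ y ∈ s, x ≠ y → r x y ∨ r y x

/-- The raw data of a framing. Only the comparisons of two edges that leave the same vertex, of
two edges that enter the same vertex, and of two starting vertices of routes are used; which of
them have to be total orders is said in `IsConsFraming` and `Augmentation.IsFraming`. -/
structure FramingData (V E : Type*) where
  /-- The order on the edges that leave a vertex. -/
  outLt : E → E → Prop
  /-- The order on the edges that enter a vertex. -/
  inLt : E → E → Prop
  /-- The order on the sources. -/
  srcLt : V → V → Prop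

/-- A framing of a directed graph with conservationist netflow vector: total orders on the outgoing
edges of each vertex that is not a sink, on the incoming edges of each internal vertex,
and on the set of sources. -/
structure IsConsFraming {V E : Type*} (G : DirGraph V E) (F : FramingData V E) : Prop where
  out : ∀ i, ¬ G.IsSink i → TotalOrderOn F.outLt (G.outEdges i)
  inc : ∀ i, G.IsInternal i → TotalOrderOn F.inLt (G.inEdges i)
  src : TotalOrderOn F.srcLt {i | G.IsSource i}

section Layerings

variable {V E : Type*} {G : DirGraph V E}

/-- The comparison of two paths with the same first vertex: at the end of their longest common
initial part, `p` continues with an edge `f`, `q` continues with an edge `g`, and `f` is smaller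
than `g` in the order on outgoing edges. -/
def FramingData.PostLt (F : FramingData V E) (p q : List E) : Prop :=
  ∃ (σ p₁ q₁ : List E) (f g : E),
    p = σ ++ f :: p₁ ∧ q = σ ++ g :: q₁ ∧ f ≠ g ∧ F.outLt f g

/-- The comparison of two paths with the same last vertex: their longest common final part is
preceded by an edge `f` in `p` and by an edge `g` in `q`, and `f` is smaller than `g` in the
order on incoming edges. -/
def FramingData.PreLt (F : FramingData V E) (p q : List E) : Prop :=
  ∃ (σ p₁ q₁ : List E) (f g : E),
    p = p₁ ++ f :: σ ∧ q = q₁ ++ g :: σ ∧ f ≠ g ∧ F.inLt f g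

/-- Both routes pass through the vertex `i`; up to `i` the route `p` is smaller than `q`, and
from `i` on the route `q` is smaller than `p`. -/
def FramingData.CrossAt (F : FramingData V E) (i : V) (p q : G.Route) : Prop :=
  ∃ p₁ p₂ q₁ q₂ : List E,
    p.edges = p₁ ++ p₂ ∧ G.IsPath p.start p₁ i ∧ G.IsPath i p₂ p.finish ∧
    q.edges = q₁ ++ q₂ ∧ G.IsPath q.start q₁ i ∧ G.IsPath i q₂ q.finish ∧
    F.PreLt p₁ q₁ ∧ F.PostLt q₂ p₂

/-- Two routes are compatible if they are not incompatible at any shared vertex. -/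
def FramingData.Compatible (F : FramingData V E) (p q : G.Route) : Prop :=
  ∀ i, ¬ F.CrossAt i p q ∧ ¬ F.CrossAt i q p

/-- A route-clique is a set of pairwise compatible routes. -/
def FramingData.IsRouteClique (F : FramingData V E) (R : Set G.Route) : Prop :=
  ∀ p ∈ R, ∀ q ∈ R, F.Compatible p q

open scoped Classical in
/-- A layering: a set of routes of which exactly `a i` begin at each source `i` and exactly `|a j|`
end at each sink `j`. -/
structure IsLayering (G : DirGraph V E) (a : V → ℤ) (L : Finset G.Route) : Prop where
  source : ∀ i, G.IsSource i → ((L.filter fun p => p.start = i).card : ℤ) = a i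
  sink : ∀ j, G.IsSink j → ((L.filter fun p => p.finish = j).card : ℤ) = |a j|

/-- The post-source order on layerings: `L` is smaller than `M` if, at the greatest
source at which they have different routes, the route of `L` is smaller than that of `M`. -/
def FramingData.LayeringLt (F : FramingData V E) (L M : Finset G.Route) : Prop :=
  ∃ p ∈ L, ∃ q ∈ M, p.start = q.start ∧ F.PostLt p.edges q.edges ∧
    ∀ p₁ ∈ L, ∀ q₁ ∈ M, p₁.start = q₁.start → F.srcLt p.start p₁.start → p₁ = q₁

/-- The set of all routes that occur in a layering of the family `S`. -/
def routes (S : Set (Finset G.Route)) : Set G.Route := {p | ∃ L ∈ S, p ∈ L}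

/-- Layering-simplices. If the members are written in increasing order as `L¹ < ⋯ < Lᵐ` and
`L = Lⁱ`, then `{K ∈ 𝓛 | K = L ∨ L < K}` is `{Lⁱ, …, Lᵐ}`, and
`{K ∈ 𝓛 | L < K}` is `{Lⁱ⁺¹, …, Lᵐ}`. -/
structure IsLayeringSimplex (G : DirGraph V E) (a : V → ℤ) (F : FramingData V E)
    (𝓛 : Finset (Finset G.Route)) : Prop where
  layering : ∀ L ∈ 𝓛, IsLayering G a L
  clique : F.IsRouteClique (routes (G := G) {L | L ∈ 𝓛})
  least : ∀ L ∈ 𝓛, ∀ M : Finset G.Route, IsLayering G a M →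
    (∀ p ∈ M, p ∈ routes {K | K ∈ 𝓛 ∧ (K = L ∨ F.LayeringLt L K)}) →
    L = M ∨ F.LayeringLt L M
  newRoute : ∀ L ∈ 𝓛, ∃ p ∈ L, p ∉ routes {K | K ∈ 𝓛 ∧ F.LayeringLt L K}

end Layerings

open scoped Classical in
/-- An augmentation of `(G, a)`, with new vertices `X` and `Y` (the inflow and the
outflow vertices) and new edges `EX` (from `X` to `V`) and `EY` (from `V` to `Y`). -/
structure Augmentation {V E : Type*} (G : DirGraph V E) (a : V → ℤ) (X Y EX EY : Type*)
    [Fintype EX] [Fintype EY] where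
  /-- The beginning of an inflow edge. -/
  xTail : EX → X
  /-- The end of an inflow edge. -/
  xHead : EX → V
  /-- The beginning of an outflow edge. -/
  yTail : EY → V
  /-- The end of an outflow edge. -/
  yHead : EY → Y
  /-- The new netflow at the outflow vertices. -/
  yNetflow : Y → ℤ
  /-- Every inflow vertex is on exactly one inflow edge. -/
  xTail_bijective : Function.Bijective xTail
  xHead_pos : ∀ x, 0 < a (xHead x)
  card_inflow : ∀ i, 0 < a i → (Nat.card {x : EX // xHead x = i} : ℤ) = a i
  /-- Every outflow vertex is on exactly one outflow edge. -/
  yHead_bijective : Function.Bijective yHead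
  yTail_neg : ∀ y, a (yTail y) < 0
  one_le_card_outflow : ∀ i, a i < 0 → (1 : ℤ) ≤ Nat.card {y : EY // yTail y = i}
  card_outflow_le : ∀ i, a i < 0 → (Nat.card {y : EY // yTail y = i} : ℤ) ≤ |a i|
  yNetflow_neg : ∀ y, yNetflow y < 0
  sum_yNetflow : ∀ i, a i < 0 → a i = ∑ y with yTail y = i, yNetflow (yHead y)

namespace Augmentation

variable {V E X Y EX EY : Type*} [Fintype EX] [Fintype EY] {G : DirGraph V E} {a : V → ℤ}

/-- The augmented graph. -/
def graph (A : Augmentation G a X Y EX EY) : DirGraph (V ⊕ X ⊕ Y) (E ⊕ EX ⊕ EY) where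
  tail
    | .inl e => .inl (G.tail e)
    | .inr (.inl x) => .inr (.inl (A.xTail x))
    | .inr (.inr y) => .inl (A.yTail y)
  head
    | .inl e => .inl (G.head e)
    | .inr (.inl x) => .inl (A.xHead x)
    | .inr (.inr y) => .inr (.inr (A.yHead y))

/-- The netflow vector of the augmented graph. -/
def netflow (A : Augmentation G a X Y EX EY) : V ⊕ X ⊕ Y → ℤ
  | .inl _ => 0
  | .inr (.inl _) => 1
  | .inr (.inr y) => A.yNetflow y

/-- A framing of an augmentation: total orders on the outgoing and on the incoming edges, in the
augmented graph, of each old vertex, and a total order on the set of inflow vertices. -/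
structure IsFraming (A : Augmentation G a X Y EX EY)
    (F : FramingData (V ⊕ X ⊕ Y) (E ⊕ EX ⊕ EY)) : Prop where
  out : ∀ i : V, TotalOrderOn F.outLt (A.graph.outEdges (.inl i))
  inc : ∀ i : V, TotalOrderOn F.inLt (A.graph.inEdges (.inl i))
  src : TotalOrderOn F.srcLt (Set.range fun x : X => Sum.inr (Sum.inl x))

end Augmentation

end FramedFlow

/-!
The flows of the layerings are the vertices of a triangulation of the flow polytope whose faces are
the layering-simplices, and a maximal face of a triangulation of a polytope `P` has `dim P + 1`
vertices: a point of `P` near its barycenter has barycentric coordinates supported on the same face.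

That every flow `f` has unique barycentric coordinates is shown in two steps. First, `f` is induced
by unique weights on the routes of a clique: at each vertex, the weights of the paths that arrive
by an edge and those of the paths that continue to a sink are two distributions of the same mass on
chains, and compatibility of routes forces them to be coupled monotonically. Second, these weights
come from unique weights on the layerings of a layering-simplex: the least layering supported on
the clique, which exists by the integrality of transport polytopes, is subtracted with the largest
possible coefficient, and the process repeats.

In an augmentation, the netflow determines the flow on all new edges, so the flow polytope of the
augmented graph is an affine copy of the original one.
-/

namespace FramedFlow

open scoped Classical

namespace TotalOrderOn

variable {α β ι : Type*} {r : α → α → Prop} {s t : Set α}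

theorem asymm (h : TotalOrderOn r s) {x y : α} (hx : x ∈ s) (hy : y ∈ s) (hxy : r x y) :
    ¬ r y x :=
  fun hyx => h.irrefl x hx (h.trans x hx y hy x hx hxy hyx)

theorem mono (h : TotalOrderOn r s) (hts : t ⊆ s) : TotalOrderOn r t where
  irrefl x hx := h.irrefl x (hts hx)
  trans x hx y hy z hz := h.trans x (hts hx) y (hts hy) z (hts hz)
  total x hx y hy := h.total x (hts hx) y (hts hy)

theorem swap (h : TotalOrderOn r s) : TotalOrderOn (fun x y => r y x) s where
  irrefl := h.irrefl
  trans x hx y hy z hz hxy hyz := h.trans z hz y hy x hx hyz hxy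
  total x hx y hy hne := (h.total x hx y hy hne).symm

theorem of_iff_map {r' : β → β → Prop} {t : Set β} (h : TotalOrderOn r' t) {f : α → β}
    (hmaps : Set.MapsTo f s t) (hinj : Set.InjOn f s)
    (hr : ∀ x ∈ s, ∀ y ∈ s, r x y ↔ r' (f x) (f y)) : TotalOrderOn r s where
  irrefl x hx hxx := h.irrefl _ (hmaps hx) ((hr x hx x hx).1 hxx)
  trans x hx y hy z hz hxy hyz := (hr x hx z hz).2 <|
    h.trans _ (hmaps hx) _ (hmaps hy) _ (hmaps hz) ((hr x hx y hy).1 hxy) ((hr y hy z hz).1 hyz)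
  total x hx y hy hne := by
    rw [hr x hx y hy, hr y hy x hx]
    exact h.total _ (hmaps hx) _ (hmaps hy) (hinj.ne hx hy hne)

theorem ne_and (h : TotalOrderOn r s) : TotalOrderOn (fun x y => x ≠ y ∧ r x y) s :=
  h.of_iff_map (f := id) (Set.mapsTo_id s) (Set.injOn_id s) fun x hx _ _ =>
    and_iff_right_of_imp fun hxy heq => h.irrefl x hx (heq ▸ hxy)

theorem of_subsingleton (hs : s.Subsingleton) : TotalOrderOn (fun x y => x ≠ y ∧ r x y) s where
  irrefl _ _ hx := hx.1 rfl
  trans _ hx _ hy _ _ hxy _ := absurd (hs hx hy) hxy.1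
  total _ hx _ hy hne := absurd (hs hx hy) hne

theorem exists_least (h : TotalOrderOn r s) (hs : s.Finite) (hne : s.Nonempty) :
    ∃ x ∈ s, ∀ y ∈ s, x = y ∨ r x y := by
  induction s, hs using Set.Finite.induction_on with
  | empty => exact absurd hne Set.not_nonempty_empty
  | @insert a s _ _ ih =>
    rcases s.eq_empty_or_nonempty with rfl | hs'
    · exact ⟨a, by simp, by simp⟩
    obtain ⟨x, hx, hleast⟩ := ih (h.mono (Set.subset_insert a s)) hs'
    have hxs := Set.mem_insert_of_mem a hx
    have has := Set.mem_insert a s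
    by_cases hax : r a x
    · refine ⟨a, has, Set.forall_mem_insert.2 ⟨Or.inl rfl, fun y hy => Or.inr ?_⟩⟩
      rcases hleast y hy with rfl | hxy
      · exact hax
      · exact h.trans a has x hxs y (Set.mem_insert_of_mem a hy) hax hxy
    · refine ⟨x, hxs, Set.forall_mem_insert.2 ⟨?_, hleast⟩⟩
      exact or_iff_not_imp_left.2 fun hxa => (h.total x hxs a has hxa).resolve_right hax

theorem lex [Finite ι] {r : ι → ι → Prop} (hr : TotalOrderOn r Set.univ) {lt : α → α → Prop}
    {T : ι → Set α} (hlt : ∀ i, TotalOrderOn lt (T i)) :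
    TotalOrderOn (fun x y : ι → α => ∃ i, lt (x i) (y i) ∧ ∀ j, r i j → x j = y j)
      (Set.univ.pi T) where
  irrefl := fun x hx ⟨i, hi, _⟩ => (hlt i).irrefl _ (hx i trivial) hi
  trans := by
    rintro x hx y hy z hz ⟨i, hi, hgt⟩ ⟨k, hk, hgt'⟩
    have mem {w : ι → α} (hw : w ∈ Set.univ.pi T) (j : ι) : w j ∈ T j := hw j trivial
    rcases eq_or_ne i k with rfl | hik
    · exact ⟨i, (hlt i).trans _ (mem hx i) _ (mem hy i) _ (mem hz i) hi hk,
        fun j hj => (hgt j hj).trans (hgt' j hj)⟩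
    rcases hr.total i trivial k trivial hik with hik | hki
    · exact ⟨k, hgt k hik ▸ hk, fun j hj =>
        (hgt j (hr.trans i trivial k trivial j trivial hik hj)).trans (hgt' j hj)⟩
    · exact ⟨i, hgt' i hki ▸ hi, fun j hj =>
        (hgt j hj).trans (hgt' j (hr.trans k trivial i trivial j trivial hki hj))⟩
  total x hx y hy hne := by
    obtain ⟨i, hi, hgreatest⟩ := (hr.mono (Set.subset_univ {i | x i ≠ y i})).swap.exists_least
      (Set.toFinite _) (Function.ne_iff.1 hne)
    have hagree : ∀ j, r i j → x j = y j := by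
      intro j hij
      by_contra hj
      rcases hgreatest j hj with rfl | hji
      · exact hr.irrefl i trivial hij
      · exact hr.asymm trivial trivial hij hji
    exact ((hlt i).total _ (hx i trivial) _ (hy i trivial) hi).imp
      (fun h => ⟨i, h, hagree⟩) (fun h => ⟨i, h, fun j hj => (hagree j hj).symm⟩)

end TotalOrderOn

section ChainCoupling

variable {α β K : Type*} [AddCommGroup K] {r : α → α → Prop} {s : β → β → Prop}
  {A : Finset α} {B : Finset β} {row : α → K} {col : β → K} {M M' : α → β → K}

theorem sum_update_sub {b₀ : β} (hb₀ : b₀ ∈ B) (x : K) :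
    ∑ b ∈ B, Function.update col b₀ (col b₀ - x) b = ∑ b ∈ B, col b - x := by
  rw [Finset.sum_update_of_mem hb₀, ← Finset.add_sum_erase B col hb₀,
    Finset.sdiff_singleton_eq_erase]
  abel

variable [LinearOrder K]

/-- A nonnegative matrix with prescribed row and column sums in which no two nonzero entries are
in antitone position, so that its support is a chain: the result of the north-west corner rule. -/
structure IsChainCoupling (r : α → α → Prop) (s : β → β → Prop) (A : Finset α) (B : Finset β)
    (row : α → K) (col : β → K) (M : α → β → K) : Prop where
  nonneg : ∀ a ∈ A, ∀ b ∈ B, 0 ≤ M a b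
  row_sum : ∀ a ∈ A, ∑ b ∈ B, M a b = row a
  col_sum : ∀ b ∈ B, ∑ a ∈ A, M a b = col b
  chain : ∀ a ∈ A, ∀ a' ∈ A, ∀ b ∈ B, ∀ b' ∈ B, r a a' → s b' b → M a b = 0 ∨ M a' b' = 0

namespace IsChainCoupling

theorem transpose (h : IsChainCoupling r s A B row col M) :
    IsChainCoupling s r B A col row (fun b a => M a b) where
  nonneg b hb a ha := h.nonneg a ha b hb
  row_sum := h.col_sum
  col_sum := h.row_sum
  chain b hb b' hb' a ha a' ha' hbb haa := (h.chain a' ha' a ha b' hb' b hb haa hbb).symm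

theorem congr (h : IsChainCoupling r s A B row col M) (hM : ∀ a ∈ A, ∀ b ∈ B, M' a b = M a b) :
    IsChainCoupling r s A B row col M' where
  nonneg a ha b hb := hM a ha b hb ▸ h.nonneg a ha b hb
  row_sum a ha := (Finset.sum_congr rfl (hM a ha)).trans (h.row_sum a ha)
  col_sum b hb := (Finset.sum_congr rfl fun a ha => hM a ha b hb).trans (h.col_sum b hb)
  chain a ha a' ha' b hb b' hb' haa hbb := by
    rw [hM a ha b hb, hM a' ha' b' hb']
    exact h.chain a ha a' ha' b hb b' hb' haa hbb

theorem extend_row {a₀ : α} {b₀ : β} (hA : TotalOrderOn r (A : Set α))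
    (hB : TotalOrderOn s (B : Set β)) (ha₀ : a₀ ∈ A) (hb₀ : b₀ ∈ B)
    (ha_least : ∀ a ∈ A, a₀ = a ∨ r a₀ a) (hb_least : ∀ b ∈ B, b₀ = b ∨ s b₀ b)
    (hrow : 0 ≤ row a₀)
    (h : IsChainCoupling r s (A.erase a₀) B row (Function.update col b₀ (col b₀ - row a₀)) M) :
    IsChainCoupling r s A B row col (Function.update M a₀ (Pi.single b₀ (row a₀))) where
  nonneg a ha b hb := by
    rcases eq_or_ne a a₀ with rfl | hne
    · rw [Function.update_self]
      exact (Pi.single_nonneg.2 hrow : (0 : β → K) ≤ _) b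
    · rw [Function.update_of_ne hne]
      exact h.nonneg a (Finset.mem_erase.2 ⟨hne, ha⟩) b hb
  row_sum a ha := by
    rcases eq_or_ne a a₀ with rfl | hne
    · rw [Function.update_self, Finset.sum_pi_single', if_pos hb₀]
    · rw [Function.update_of_ne hne]
      exact h.row_sum a (Finset.mem_erase.2 ⟨hne, ha⟩)
  col_sum b hb := by
    have herase : ∑ a ∈ A.erase a₀, Function.update M a₀ (Pi.single b₀ (row a₀)) a b =
        Function.update col b₀ (col b₀ - row a₀) b := by
      rw [← h.col_sum b hb]
      exact Finset.sum_congr rfl fun a ha => by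
        rw [Function.update_of_ne (Finset.ne_of_mem_erase ha)]
    rw [← Finset.add_sum_erase A _ ha₀, herase, Function.update_self]
    rcases eq_or_ne b b₀ with rfl | hne
    · simp
    · simp [hne]
  chain a ha a' ha' b hb b' hb' haa hbb := by
    have ha'₀ : a' ≠ a₀ := by
      rintro rfl
      exact (ha_least a ha).elim (fun h => hA.irrefl a ha (h ▸ haa)) (hA.asymm ha ha' haa)
    rcases eq_or_ne a a₀ with rfl | hne
    · have hb₀ : b ≠ b₀ := by
        rintro rfl
        exact (hb_least b' hb').elim (fun h => hB.irrefl b hb (h ▸ hbb)) (hB.asymm hb' hb hbb)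
      exact Or.inl (by rw [Function.update_self, Pi.single_eq_of_ne hb₀])
    · rw [Function.update_of_ne hne, Function.update_of_ne ha'₀]
      exact h.chain a (Finset.mem_erase.2 ⟨hne, ha⟩) a' (Finset.mem_erase.2 ⟨ha'₀, ha'⟩)
        b hb b' hb' haa hbb

end IsChainCoupling

variable [IsOrderedAddMonoid K]

theorem update_sub_nonneg {b₀ : β} {x : K} (hcol : ∀ b ∈ B, 0 ≤ col b) (hx : x ≤ col b₀) :
    ∀ b ∈ B, 0 ≤ Function.update col b₀ (col b₀ - x) b := by
  intro b hb
  rcases eq_or_ne b b₀ with rfl | hne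
  · simpa using hx
  · simpa [hne] using hcol b hb

theorem exists_isChainCoupling (hA : TotalOrderOn r (A : Set α)) (hB : TotalOrderOn s (B : Set β))
    (hrow : ∀ a ∈ A, 0 ≤ row a) (hcol : ∀ b ∈ B, 0 ≤ col b)
    (hsum : ∑ a ∈ A, row a = ∑ b ∈ B, col b) :
    ∃ M, IsChainCoupling r s A B row col M := by
  induction hn : A.card + B.card generalizing A B row col with
  | zero =>
    obtain ⟨rfl, rfl⟩ : A = ∅ ∧ B = ∅ := by simpa using hn
    exact ⟨0, by constructor <;> simp⟩
  | succ n ih =>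
    rcases A.eq_empty_or_nonempty with rfl | hA'
    · rw [Finset.sum_empty, eq_comm, Finset.sum_eq_zero_iff_of_nonneg hcol] at hsum
      exact ⟨0, by simp, by simp, fun b hb => by simp [hsum b hb], by simp⟩
    rcases B.eq_empty_or_nonempty with rfl | hB'
    · rw [Finset.sum_empty, Finset.sum_eq_zero_iff_of_nonneg hrow] at hsum
      exact ⟨0, by simp, fun a ha => by simp [hsum a ha], by simp, by simp⟩
    obtain ⟨a₀, ha₀, ha_least⟩ := hA.exists_least A.finite_toSet hA'
    obtain ⟨b₀, hb₀, hb_least⟩ := hB.exists_least B.finite_toSet hB'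
    rw [Finset.mem_coe] at ha₀ hb₀
    rcases le_total (row a₀) (col b₀) with hle | hle
    · obtain ⟨M, hM⟩ := ih (A := A.erase a₀)
        (hA.mono (Finset.coe_subset.2 (A.erase_subset a₀))) hB
        (fun a ha => hrow a (Finset.mem_of_mem_erase ha)) (update_sub_nonneg hcol hle)
        (by rw [sum_update_sub hb₀, ← hsum, Finset.sum_erase_eq_sub ha₀])
        (by have := Finset.card_erase_add_one ha₀; omega)
      exact ⟨_, hM.extend_row hA hB ha₀ hb₀ ha_least hb_least (hrow a₀ ha₀)⟩
    · obtain ⟨M, hM⟩ := ih (B := B.erase b₀) hA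
        (hB.mono (Finset.coe_subset.2 (B.erase_subset b₀))) (update_sub_nonneg hrow hle)
        (fun b hb => hcol b (Finset.mem_of_mem_erase hb))
        (by rw [sum_update_sub ha₀, hsum, Finset.sum_erase_eq_sub hb₀])
        (by have := Finset.card_erase_add_one hb₀; omega)
      exact ⟨_, (hM.transpose.extend_row hB hA hb₀ ha₀ hb_least ha_least (hcol b₀ hb₀)).transpose⟩

/-- A chain coupling with the given row and column sums, and `0` if there is none. -/
noncomputable def chainCoupling (r : α → α → Prop) (s : β → β → Prop) (A : Finset α)
    (B : Finset β) (row : α → K) (col : β → K) : α → β → K :=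
  if h : ∃ M, IsChainCoupling r s A B row col M then h.choose else 0

theorem isChainCoupling_chainCoupling (hA : TotalOrderOn r (A : Set α))
    (hB : TotalOrderOn s (B : Set β)) (hrow : ∀ a ∈ A, 0 ≤ row a) (hcol : ∀ b ∈ B, 0 ≤ col b)
    (hsum : ∑ a ∈ A, row a = ∑ b ∈ B, col b) :
    IsChainCoupling r s A B row col (chainCoupling r s A B row col) := by
  have h := exists_isChainCoupling hA hB hrow hcol hsum
  rw [chainCoupling, dif_pos h]
  exact h.choose_spec

/-- An initial segment of the finite set `A` ordered by `r`. -/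
structure IsInitialIn (r : α → α → Prop) (S A : Finset α) : Prop where
  subset : S ⊆ A
  lt : ∀ x ∈ S, ∀ y ∈ A \ S, r x y

theorem TotalOrderOn.isInitialIn_filter (hA : TotalOrderOn r (A : Set α)) {a : α} (ha : a ∈ A) :
    IsInitialIn r {x ∈ A | r x a} A where
  subset := Finset.filter_subset _ _
  lt x hx y hy := by
    simp only [Finset.mem_filter, Finset.mem_sdiff, not_and] at hx hy
    rcases eq_or_ne y a with rfl | hne
    · exact hx.2
    · exact hA.trans x hx.1 a ha y hy.1 hx.2 <|
        (hA.total y hy.1 a ha hne).resolve_left (hy.2 hy.1)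

theorem TotalOrderOn.isInitialIn_insert_filter (hA : TotalOrderOn r (A : Set α)) {a : α}
    (ha : a ∈ A) : IsInitialIn r (insert a {x ∈ A | r x a}) A where
  subset := Finset.insert_subset ha (Finset.filter_subset _ _)
  lt x hx y hy := by
    simp only [Finset.mem_insert, Finset.mem_filter, Finset.mem_sdiff, not_or, not_and] at hx hy
    have hay : r a y := (hA.total y hy.1 a ha hy.2.1).resolve_left (hy.2.2 hy.1)
    rcases hx with rfl | ⟨hx, hxa⟩
    · exact hay
    · exact hA.trans x hx a ha y hy.1 hxa hay

namespace IsChainCoupling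

theorem sum_sum_eq_min (h : IsChainCoupling r s A B row col M) {S : Finset α} {T : Finset β}
    (hS : IsInitialIn r S A) (hT : IsInitialIn s T B) :
    ∑ a ∈ S, ∑ b ∈ T, M a b = min (∑ a ∈ S, row a) (∑ b ∈ T, col b) := by
  have hrow : ∑ a ∈ S, row a = ∑ a ∈ S, ∑ b ∈ T, M a b + ∑ a ∈ S, ∑ b ∈ B \ T, M a b := by
    rw [← Finset.sum_add_distrib]
    refine Finset.sum_congr rfl fun a ha => ?_
    rw [add_comm, Finset.sum_sdiff hT.subset, h.row_sum a (hS.subset ha)]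
  have hcol : ∑ b ∈ T, col b = ∑ a ∈ S, ∑ b ∈ T, M a b + ∑ a ∈ A \ S, ∑ b ∈ T, M a b := by
    rw [add_comm, Finset.sum_sdiff hS.subset, Finset.sum_comm]
    exact Finset.sum_congr rfl fun b hb => (h.col_sum b (hT.subset hb)).symm
  have hS_nonneg : 0 ≤ ∑ a ∈ S, ∑ b ∈ B \ T, M a b := Finset.sum_nonneg fun a ha =>
    Finset.sum_nonneg fun b hb => h.nonneg a (hS.subset ha) b (Finset.sdiff_subset hb)
  have hT_nonneg : 0 ≤ ∑ a ∈ A \ S, ∑ b ∈ T, M a b := Finset.sum_nonneg fun a ha =>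
    Finset.sum_nonneg fun b hb => h.nonneg a (Finset.sdiff_subset ha) b (hT.subset hb)
  have hzero : (∑ a ∈ S, ∑ b ∈ B \ T, M a b = 0) ∨ ∑ a ∈ A \ S, ∑ b ∈ T, M a b = 0 := by
    refine or_iff_not_imp_left.2 fun hne => ?_
    obtain ⟨a, ha, hne⟩ := Finset.exists_ne_zero_of_sum_ne_zero hne
    obtain ⟨b, hb, hne⟩ := Finset.exists_ne_zero_of_sum_ne_zero hne
    refine Finset.sum_eq_zero fun a' ha' => Finset.sum_eq_zero fun b' hb' => ?_
    exact (h.chain a (hS.subset ha) a' (Finset.sdiff_subset ha') b (Finset.sdiff_subset hb)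
      b' (hT.subset hb') (hS.lt a ha a' ha') (hT.lt b' hb' b hb)).resolve_left hne
  rw [hrow, hcol, min_add_add_left]
  rcases hzero with hzero | hzero <;> simp [hzero, hS_nonneg, hT_nonneg]

theorem unique (hA : TotalOrderOn r (A : Set α)) (hB : TotalOrderOn s (B : Set β))
    (h : IsChainCoupling r s A B row col M) (h' : IsChainCoupling r s A B row col M') :
    ∀ a ∈ A, ∀ b ∈ B, M a b = M' a b := by
  intro a ha b hb
  have cumulative {S : Finset α} {T : Finset β} (hS : IsInitialIn r S A) (hT : IsInitialIn s T B) :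
      ∑ a ∈ S, ∑ b ∈ T, M a b = ∑ a ∈ S, ∑ b ∈ T, M' a b :=
    (h.sum_sum_eq_min hS hT).trans (h'.sum_sum_eq_min hS hT).symm
  have row_cumulative {T : Finset β} (hT : IsInitialIn s T B) :
      ∑ b ∈ T, M a b = ∑ b ∈ T, M' a b := by
    have heq := cumulative (hA.isInitialIn_insert_filter ha) hT
    have ha' : a ∉ A.filter (r · a) := by simp [hA.irrefl a ha]
    rw [Finset.sum_insert ha', Finset.sum_insert ha',
      cumulative (hA.isInitialIn_filter ha) hT] at heq
    exact add_right_cancel heq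
  have heq := row_cumulative (hB.isInitialIn_insert_filter hb)
  have hb' : b ∉ B.filter (s · b) := by simp [hB.irrefl b hb]
  rw [Finset.sum_insert hb', Finset.sum_insert hb',
    row_cumulative (hB.isInitialIn_filter hb)] at heq
  exact add_right_cancel heq

end IsChainCoupling

end ChainCoupling

namespace DirGraph

variable {V E : Type*} {G : DirGraph V E}

theorem isPath_append {u v : V} {p q : List E} :
    G.IsPath u (p ++ q) v ↔ ∃ m, G.IsPath u p m ∧ G.IsPath m q v := by
  induction p generalizing u with
  | nil => simp [IsPath]
  | cons e p ih => simp [IsPath, ih, and_assoc]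

namespace IsPath

theorem append {u m v : V} {p q : List E} (hp : G.IsPath u p m) (hq : G.IsPath m q v) :
    G.IsPath u (p ++ q) v :=
  isPath_append.2 ⟨m, hp, hq⟩

theorem end_unique {u v v' : V} {p : List E} (h : G.IsPath u p v) (h' : G.IsPath u p v') :
    v = v' := by
  induction p generalizing u with
  | nil => exact Eq.trans (Eq.symm h) h'
  | cons e p ih => exact ih h.2 h'.2

theorem start_unique {u u' v : V} {p : List E} (h : G.IsPath u p v) (h' : G.IsPath u' p v) :
    u = u' := by
  cases p with
  | nil => exact Eq.trans h (Eq.symm h')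
  | cons e p => exact h.1.symm.trans h'.1

theorem nodup (hG : G.Acyclic) {u v : V} {p : List E} (h : G.IsPath u p v) : p.Nodup := by
  induction p generalizing u with
  | nil => exact List.nodup_nil
  | cons e p ih =>
    refine List.nodup_cons.2 ⟨fun he => ?_, ih h.2⟩
    obtain ⟨l, r, rfl⟩ := List.append_of_mem he
    obtain ⟨m, hm, hm'⟩ := isPath_append.1 h.2
    have hcycle : G.IsPath m (e :: l) m := ⟨hm'.1, hm'.1 ▸ hm⟩
    exact List.cons_ne_nil _ _ (hG m _ hcycle)

theorem eq_nil_of_isSink {u v : V} {p : List E} (h : G.IsPath u p v) (hu : G.IsSink u) :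
    p = [] := by
  cases p with
  | nil => rfl
  | cons e p => exact absurd h.1 (hu e)

theorem eq_nil_or_concat {u v : V} {p : List E} (h : G.IsPath u p v) :
    p = [] ∨ ∃ q g, p = q ++ [g] ∧ G.head g = v ∧ G.IsPath u q (G.tail g) := by
  rcases p.eq_nil_or_concat' with rfl | ⟨q, g, rfl⟩
  · exact Or.inl rfl
  · obtain ⟨m, hm, rfl, hg⟩ := isPath_append.1 h
    exact Or.inr ⟨q, g, rfl, hg, hm⟩

theorem eq_nil_of_isSource {u v : V} {p : List E} (h : G.IsPath u p v) (hv : G.IsSource v) :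
    p = [] :=
  h.eq_nil_or_concat.resolve_right fun ⟨_, g, _, hg, _⟩ => hv g hg

end IsPath

theorem Acyclic.finite_setOf_isPath [Finite E] (hG : G.Acyclic) :
    {p | ∃ u v, G.IsPath u p v}.Finite := by
  cases nonempty_fintype E
  exact (Set.finite_range ((↑) : {l : List E // l.Nodup} → List E)).subset
    fun p ⟨_, _, h⟩ => ⟨⟨p, h.nodup hG⟩, rfl⟩

theorem Route.ext_of_edges {P Q : G.Route} (hstart : P.start = Q.start)
    (hedges : P.edges = Q.edges) : P = Q :=
  Route.ext hstart (P.isPath.end_unique (hstart ▸ hedges ▸ Q.isPath)) hedges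

theorem Route.finite [Finite V] [Finite E] (hG : G.Acyclic) : Finite G.Route := by
  have := hG.finite_setOf_isPath.to_subtype
  let f (P : G.Route) : V × {p | ∃ u v, G.IsPath u p v} :=
    (P.start, ⟨P.edges, P.start, P.finish, P.isPath⟩)
  refine Finite.of_injective f fun P Q h => ?_
  simp only [f, Prod.mk.injEq, Subtype.mk.injEq] at h
  exact Route.ext_of_edges h.1 h.2

/-- There is a nontrivial path from `u` to `v`. -/
def Reaches (G : DirGraph V E) (u v : V) : Prop := ∃ p ≠ [], G.IsPath u p v

theorem reaches_edge (e : E) : G.Reaches (G.tail e) (G.head e) :=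
  ⟨[e], List.cons_ne_nil _ _, rfl, rfl⟩

theorem Acyclic.isStrictOrder_reaches (hG : G.Acyclic) : IsStrictOrder V G.Reaches where
  irrefl := fun v ⟨p, hp, h⟩ => hp (hG v p h)
  trans := fun _ _ _ ⟨p, hp, h⟩ ⟨q, _, h'⟩ => ⟨p ++ q, by simp [hp], h.append h'⟩

theorem Acyclic.wellFounded_reaches [Finite V] (hG : G.Acyclic) : WellFounded G.Reaches :=
  have := hG.isStrictOrder_reaches
  Finite.wellFounded_of_trans_of_irrefl _

theorem Acyclic.wellFounded_swap_reaches [Finite V] (hG : G.Acyclic) :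
    WellFounded (Function.swap G.Reaches) :=
  have := hG.isStrictOrder_reaches
  Finite.wellFounded_of_trans_of_irrefl _

/-- The edge list `q` is a path from `v` to a sink. -/
def IsSinkPath (G : DirGraph V E) (v : V) (q : List E) : Prop := ∃ t, G.IsSink t ∧ G.IsPath v q t

theorem isSinkPath_nil {v : V} : G.IsSinkPath v [] ↔ G.IsSink v :=
  ⟨fun ⟨_, ht, h⟩ => Eq.symm h ▸ ht, fun h => ⟨v, h, rfl⟩⟩

theorem isSinkPath_cons {v : V} {e : E} {q : List E} :
    G.IsSinkPath v (e :: q) ↔ G.tail e = v ∧ G.IsSinkPath (G.head e) q :=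
  ⟨fun ⟨t, ht, h, h'⟩ => ⟨h, t, ht, h'⟩, fun ⟨h, t, ht, h'⟩ => ⟨t, ht, h, h'⟩⟩

theorem IsSinkPath.eq_nil {v : V} {q : List E} (h : G.IsSinkPath v q) (hv : G.IsSink v) :
    q = [] :=
  h.elim fun _ ht => ht.2.eq_nil_of_isSink hv

theorem Route.isSinkPath (P : G.Route) : G.IsSinkPath P.start P.edges :=
  ⟨P.finish, P.finish_isSink, P.isPath⟩

section SinkPaths

variable [Finite E]

theorem Acyclic.finite_setOf_isSinkPath (hG : G.Acyclic) (v : V) :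
    {q | G.IsSinkPath v q}.Finite :=
  hG.finite_setOf_isPath.subset fun _ ⟨t, _, h⟩ => ⟨v, t, h⟩

/-- The finite set of all paths from `v` to the sinks. -/
noncomputable def Acyclic.sinkPaths (hG : G.Acyclic) (v : V) : Finset (List E) :=
  (hG.finite_setOf_isSinkPath v).toFinset

@[simp]
theorem mem_sinkPaths (hG : G.Acyclic) {v : V} {q : List E} :
    q ∈ hG.sinkPaths v ↔ G.IsSinkPath v q := by
  simp [Acyclic.sinkPaths]

theorem sinkPaths_of_isSink (hG : G.Acyclic) {v : V} (hv : G.IsSink v) :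
    hG.sinkPaths v = {[]} :=
  Finset.ext fun q => by
    rw [mem_sinkPaths, Finset.mem_singleton]
    exact ⟨fun h => h.eq_nil hv, fun h => h ▸ isSinkPath_nil.2 hv⟩

theorem sum_sinkPaths_of_not_isSink {V E K : Type*} [Fintype E] [AddCommMonoid K]
    {G : DirGraph V E} (hG : G.Acyclic) {v : V} (hv : ¬ G.IsSink v) (w : List E → K) :
    ∑ q ∈ hG.sinkPaths v, w q =
      ∑ e with G.tail e = v, ∑ q ∈ hG.sinkPaths (G.head e), w (e :: q) := by
  rw [Finset.sum_sigma']
  symm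
  refine Finset.sum_bij (fun x _ => x.1 :: x.2) ?_ ?_ ?_ fun _ _ => rfl
  · rintro ⟨e, q⟩ h
    simpa [isSinkPath_cons] using h
  · rintro ⟨e, q⟩ - ⟨e', q'⟩ - h
    obtain ⟨rfl, rfl⟩ := List.cons.inj h
    rfl
  · rintro (_ | ⟨e, q⟩) hq
    · exact absurd (isSinkPath_nil.1 ((mem_sinkPaths hG).1 hq)) hv
    · exact ⟨⟨e, q⟩, by simpa [isSinkPath_cons] using hq, rfl⟩

end SinkPaths

namespace Route

/-- The route passes through the vertex `v` and continues from there along `q`. -/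
def HasSuffix (P : G.Route) (v : V) (q : List E) : Prop :=
  ∃ l, P.edges = l ++ q ∧ G.IsPath P.start l v

theorem HasSuffix.isPath {P : G.Route} {v : V} {q : List E} (h : P.HasSuffix v q) :
    G.IsPath v q P.finish := by
  obtain ⟨l, hl, hp⟩ := h
  obtain ⟨m, hm, hm'⟩ := isPath_append.1 (hl ▸ P.isPath)
  exact hp.end_unique hm ▸ hm'

theorem HasSuffix.isSinkPath {P : G.Route} {v : V} {q : List E} (h : P.HasSuffix v q) :
    G.IsSinkPath v q :=
  ⟨P.finish, P.finish_isSink, h.isPath⟩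

theorem HasSuffix.unique (hG : G.Acyclic) {P : G.Route} {v : V} {q q' : List E}
    (h : P.HasSuffix v q) (h' : P.HasSuffix v q') : q = q' := by
  have eq_nil_of_extends {l a : List E} (hl : G.IsPath P.start l v)
      (hla : G.IsPath P.start (l ++ a) v) : a = [] := by
    obtain ⟨m, hm, ha⟩ := isPath_append.1 hla
    obtain rfl := hm.end_unique hl
    exact hG m a ha
  obtain ⟨l, hl, hp⟩ := h
  obtain ⟨l', hl', hp'⟩ := h'
  rcases List.append_eq_append_iff.1 (hl.symm.trans hl') with ⟨a, rfl, rfl⟩ | ⟨a, rfl, rfl⟩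
  · rw [eq_nil_of_extends hp hp', List.nil_append]
  · rw [eq_nil_of_extends hp' hp, List.nil_append]

theorem hasSuffix_nil {P : G.Route} {t : V} : P.HasSuffix t [] ↔ P.finish = t :=
  ⟨fun h => Eq.symm h.isPath, fun h => ⟨P.edges, by simp, h ▸ P.isPath⟩⟩

theorem hasSuffix_of_isSource {P : G.Route} {s : V} {q : List E} (hs : G.IsSource s) :
    P.HasSuffix s q ↔ P.start = s ∧ P.edges = q := by
  constructor
  · rintro ⟨l, hl, hp⟩
    obtain rfl := hp.eq_nil_of_isSource hs
    exact ⟨hp, hl⟩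
  · rintro ⟨h, h'⟩
    exact ⟨[], h', h⟩

theorem hasSuffix_start_edges {P Q : G.Route} : Q.HasSuffix P.start P.edges ↔ Q = P := by
  rw [hasSuffix_of_isSource P.start_isSource]
  exact ⟨fun h => Route.ext_of_edges h.1 h.2, fun h => h ▸ ⟨rfl, rfl⟩⟩

theorem HasSuffix.head {P : G.Route} {g : E} {q : List E} (h : P.HasSuffix (G.tail g) (g :: q)) :
    P.HasSuffix (G.head g) q := by
  obtain ⟨l, hl, hp⟩ := h
  exact ⟨l ++ [g], by simp [hl], hp.append ⟨rfl, rfl⟩⟩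

theorem HasSuffix.exists_cons {P : G.Route} {v : V} {q : List E} (h : P.HasSuffix v q)
    (hv : ¬ G.IsSource v) : ∃ g, G.head g = v ∧ P.HasSuffix (G.tail g) (g :: q) := by
  obtain ⟨l, hl, hp⟩ := h
  rcases hp.eq_nil_or_concat with rfl | ⟨l', g, rfl, hg, hl'⟩
  · exact absurd (Eq.subst (motive := G.IsSource) hp P.start_isSource) hv
  · exact ⟨g, hg, l', by simp [hl], hl'⟩

theorem HasSuffix.cons_unique {P : G.Route} {v v' : V} {q : List E} {g g' : E}
    (h : P.HasSuffix v (g :: q)) (h' : P.HasSuffix v' (g' :: q)) : g = g' := by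
  obtain ⟨l, hl, -⟩ := h
  obtain ⟨l', hl', -⟩ := h'
  exact (List.cons.inj (List.append_inj' (hl.symm.trans hl') rfl).2).1

theorem exists_hasSuffix_cons_iff {P : G.Route} {g : E} :
    (∃ q, P.HasSuffix (G.tail g) (g :: q)) ↔ g ∈ P.edges := by
  constructor
  · rintro ⟨q, l, hl, -⟩
    simp [hl]
  · intro hg
    obtain ⟨l, q, hlq⟩ := List.append_of_mem hg
    obtain ⟨m, hm, rfl, -⟩ := isPath_append.1 (hlq ▸ P.isPath)
    exact ⟨q, l, hlq, hm⟩

end Route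

section SuffixSums

variable {K : Type*} [AddCommMonoid K] [Fintype G.Route] (c : G.Route → K)

theorem sum_hasSuffix_route (P : G.Route) :
    ∑ Q : G.Route with Q.HasSuffix P.start P.edges, c Q = c P := by
  simp_rw [Finset.sum_filter, Route.hasSuffix_start_edges]
  exact Fintype.sum_ite_eq' P c

theorem sum_sum_hasSuffix_cons [Fintype E] {v : V} (hv : ¬ G.IsSource v) (q : List E) :
    ∑ g with G.head g = v, ∑ P : G.Route with P.HasSuffix (G.tail g) (g :: q), c P =
      ∑ P : G.Route with P.HasSuffix v q, c P := by
  simp_rw [Finset.sum_filter (fun P : G.Route => P.HasSuffix _ _)]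
  rw [Finset.sum_comm]
  refine Finset.sum_congr rfl fun P _ => ?_
  by_cases h : P.HasSuffix v q
  · obtain ⟨g, hg, hgP⟩ := h.exists_cons hv
    rw [if_pos h, Finset.sum_eq_single_of_mem g (by simpa using hg), if_pos hgP]
    exact fun g' _ hne => if_neg fun h' => hne (h'.cons_unique hgP)
  · rw [if_neg h]
    refine Finset.sum_eq_zero fun g hg => if_neg fun h' => h ?_
    exact (Finset.mem_filter.1 hg).2 ▸ h'.head

variable [Finite E]

theorem sum_sinkPaths_sum_hasSuffix_cons (hG : G.Acyclic) (g : E) :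
    ∑ q ∈ hG.sinkPaths (G.head g), ∑ P : G.Route with P.HasSuffix (G.tail g) (g :: q), c P =
      ∑ P : G.Route, P.edges.count g • c P := by
  simp_rw [Finset.sum_filter]
  rw [Finset.sum_comm]
  refine Finset.sum_congr rfl fun P _ => ?_
  by_cases h : g ∈ P.edges
  · obtain ⟨q, hq⟩ := Route.exists_hasSuffix_cons_iff.2 h
    have hmem : q ∈ hG.sinkPaths (G.head g) :=
      (mem_sinkPaths hG).2 hq.head.isSinkPath
    rw [List.count_eq_one_of_mem (P.isPath.nodup hG) h, one_smul,
      Finset.sum_eq_single_of_mem q hmem, if_pos hq]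
    exact fun q' _ hne => if_neg fun h' => hne (h'.head.unique hG hq.head)
  · rw [List.count_eq_zero_of_not_mem h, zero_smul]
    exact Finset.sum_eq_zero fun q _ =>
      if_neg fun h' => h (Route.exists_hasSuffix_cons_iff.1 ⟨q, h'⟩)

theorem sum_sinkPaths_sum_hasSuffix_of_isSource (hG : G.Acyclic) {s : V} (hs : G.IsSource s) :
    ∑ q ∈ hG.sinkPaths s, ∑ P : G.Route with P.HasSuffix s q, c P =
      ∑ P : G.Route with P.start = s, c P := by
  simp_rw [Finset.sum_filter, Route.hasSuffix_of_isSource hs]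
  rw [Finset.sum_comm]
  refine Finset.sum_congr rfl fun P _ => ?_
  by_cases h : P.start = s
  · obtain rfl := h
    rw [if_pos rfl, Finset.sum_eq_single_of_mem P.edges ((mem_sinkPaths hG).2 P.isSinkPath)
      fun q _ hne => if_neg fun h => hne h.2.symm, if_pos ⟨rfl, rfl⟩]
  · simp [h]

end SuffixSums

end DirGraph

section Framings

variable {V E : Type*} {G : DirGraph V E} {b : V → ℤ} {F : FramingData V E}

namespace FramingData

theorem postLt_cons {e e' : E} {p q : List E} :
    F.PostLt (e :: p) (e' :: q) ↔ (e ≠ e' ∧ F.outLt e e') ∨ (e = e' ∧ F.PostLt p q) := by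
  constructor
  · rintro ⟨_ | ⟨x, σ⟩, p₁, q₁, f, g, hp, hq, hne, hlt⟩
    · obtain ⟨rfl, rfl⟩ := List.cons.inj hp
      obtain ⟨rfl, rfl⟩ := List.cons.inj hq
      exact Or.inl ⟨hne, hlt⟩
    · simp only [List.cons_append, List.cons.injEq] at hp hq
      exact Or.inr ⟨hp.1.trans hq.1.symm, σ, p₁, q₁, f, g, hp.2, hq.2, hne, hlt⟩
  · rintro (⟨hne, hlt⟩ | ⟨rfl, σ, p₁, q₁, f, g, rfl, rfl, hne, hlt⟩)
    · exact ⟨[], p, q, e, e', rfl, rfl, hne, hlt⟩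
    · exact ⟨e :: σ, p₁, q₁, f, g, rfl, rfl, hne, hlt⟩

theorem not_postLt_nil_left {q : List E} : ¬ F.PostLt [] q := by
  rintro ⟨σ, p₁, q₁, f, g, hp, -⟩
  simp at hp

theorem not_postLt_nil_right {q : List E} : ¬ F.PostLt q [] := by
  rintro ⟨σ, p₁, q₁, f, g, -, hp, -⟩
  simp at hp

theorem postLt_irrefl (p : List E) : ¬ F.PostLt p p := by
  induction p with
  | nil => exact not_postLt_nil_left
  | cons e p ih => simpa [postLt_cons] using ih

theorem PostLt.append_left {p q : List E} (h : F.PostLt p q) (σ : List E) :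
    F.PostLt (σ ++ p) (σ ++ q) := by
  obtain ⟨τ, p₁, q₁, f, g, rfl, rfl, h⟩ := h
  exact ⟨σ ++ τ, p₁, q₁, f, g, by simp, by simp, h⟩

theorem PostLt.not_isSink {v : V} {q q' : List E} (h : F.PostLt q q')
    (hq : G.IsSinkPath v q) : ¬ G.IsSink v :=
  fun hv => F.not_postLt_nil_left (hq.eq_nil hv ▸ h)

/-- A crossing can be moved back to the vertex where the two routes first meet on their common
part. -/
theorem exists_crossAt_iff {P Q : G.Route} :
    (∃ i, F.CrossAt i P Q) ↔ ∃ e g p q, G.head e = G.head g ∧ e ≠ g ∧ F.inLt e g ∧ F.PostLt q p ∧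
      P.HasSuffix (G.tail e) (e :: p) ∧ Q.HasSuffix (G.tail g) (g :: q) := by
  constructor
  · rintro ⟨i, _, p₂, _, q₂, hp, hp₁, -, hq, hq₁, -, ⟨σ, p₀, q₀, e, g, rfl, rfl, hne, hin⟩, hpost⟩
    obtain ⟨_, hp₀, rfl, hσ⟩ := DirGraph.isPath_append.1 hp₁
    obtain ⟨_, hq₀, rfl, hσ'⟩ := DirGraph.isPath_append.1 hq₁
    exact ⟨e, g, σ ++ p₂, σ ++ q₂, hσ.start_unique hσ', hne, hin, hpost.append_left σ,
      ⟨p₀, by simp [hp], hp₀⟩, ⟨q₀, by simp [hq], hq₀⟩⟩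
  · rintro ⟨e, g, p, q, hhead, hne, hin, hpost, hP, hQ⟩
    have hp := hP.head.isPath
    have hq := hQ.head.isPath
    obtain ⟨l, hl, hpl⟩ := hP
    obtain ⟨m, hm, hpm⟩ := hQ
    exact ⟨G.head e, l ++ [e], p, m ++ [g], q, by simp [hl], hpl.append ⟨rfl, rfl⟩, hp,
      by simp [hm], hpm.append ⟨rfl, hhead.symm⟩, hhead ▸ hq,
      ⟨[], l, m, e, g, rfl, rfl, hne, hin⟩, hpost⟩

/-- The framing order on incoming edges. At a sink, where a framing need not order the incoming
edges and routes cannot cross, it is replaced by an arbitrary total order. -/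
def InOrder (F : FramingData V E) (G : DirGraph V E) (e g : E) : Prop :=
  if G.IsSink (G.head e) then WellOrderingRel e g else e ≠ g ∧ F.inLt e g

theorem inOrder_iff {e g : E} (he : ¬ G.IsSink (G.head e)) :
    F.InOrder G e g ↔ e ≠ g ∧ F.inLt e g :=
  iff_of_eq (if_neg he)

end FramingData

/-- The common part of the two notions of framing, with respect to a netflow vector that is `0`
or `1` at each source. Adding `e ≠ f` to the edge comparisons, as in `PostLt` and `PreLt`, turns
every relation into an order on the edges at a vertex with at most one of them. -/
structure IsFramed (G : DirGraph V E) (b : V → ℤ) (F : FramingData V E) : Prop where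
  out : ∀ i, TotalOrderOn (fun e f => e ≠ f ∧ F.outLt e f) (G.outEdges i)
  inc : ∀ i, ¬ G.IsSink i → TotalOrderOn (fun e f => e ≠ f ∧ F.inLt e f) (G.inEdges i)
  src : TotalOrderOn F.srcLt {s | G.IsSource s ∧ b s = 1}

namespace IsFramed

theorem totalOrderOn_inOrder (hF : IsFramed G b F) (v : V) :
    TotalOrderOn (F.InOrder G) (G.inEdges v) := by
  by_cases hv : G.IsSink v
  · refine TotalOrderOn.of_iff_map (r' := WellOrderingRel) (t := Set.univ) (f := id)
      ⟨fun x _ => irrefl x, fun x _ y _ z _ => _root_.trans, fun x _ y _ hne => ?_⟩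
      (Set.mapsTo_univ _ _) (Set.injOn_id _) ?_
    · exact (trichotomous_of WellOrderingRel x y).imp_right fun h => h.resolve_left hne
    · rintro e rfl g -
      exact iff_of_eq (if_pos hv)
  · refine (hF.inc v hv).of_iff_map (f := id) (Set.mapsTo_id _) (Set.injOn_id _) ?_
    rintro e rfl g -
    exact iff_of_eq (if_neg hv)

theorem totalOrderOn_postLt (hF : IsFramed G b F) (v : V) :
    TotalOrderOn F.PostLt {q | G.IsSinkPath v q} where
  irrefl p _ := F.postLt_irrefl p
  trans p hp q hq r hr hpq hqr := by
    induction p generalizing v q r with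
    | nil => exact absurd hpq F.not_postLt_nil_left
    | cons e p ih =>
      rcases q with _ | ⟨f, q⟩
      · exact absurd hpq F.not_postLt_nil_right
      rcases r with _ | ⟨g, r⟩
      · exact absurd hqr F.not_postLt_nil_right
      rw [Set.mem_ofPred_eq, DirGraph.isSinkPath_cons] at hp hq hr
      rw [F.postLt_cons] at hpq hqr ⊢
      rcases hpq with h | ⟨rfl, h⟩ <;> rcases hqr with h' | ⟨rfl, h'⟩
      · exact Or.inl ((hF.out v).trans e hp.1 f hq.1 g hr.1 h h')
      · exact Or.inl h
      · exact Or.inl h'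
      · exact Or.inr ⟨rfl, ih _ hp.2 q hq.2 r hr.2 h h'⟩
  total p hp q hq hne := by
    induction p generalizing v q with
    | nil => exact absurd (hq.eq_nil (DirGraph.isSinkPath_nil.1 hp)).symm hne
    | cons e p ih =>
      rcases q with _ | ⟨f, q⟩
      · exact absurd (hp.eq_nil (DirGraph.isSinkPath_nil.1 hq)) hne
      rw [Set.mem_ofPred_eq, DirGraph.isSinkPath_cons] at hp hq
      rw [F.postLt_cons, F.postLt_cons]
      rcases eq_or_ne e f with rfl | hef
      · exact (ih _ hp.2 q hq.2 (by simpa using hne)).imp (fun h => Or.inr ⟨rfl, h⟩)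
          (fun h => Or.inr ⟨rfl, h⟩)
      · exact ((hF.out v).total e hp.1 f hq.1 hef).imp Or.inl Or.inl

theorem totalOrderOn_sinkPaths [Finite E] (hF : IsFramed G b F) (hG : G.Acyclic) (v : V) :
    TotalOrderOn F.PostLt (hG.sinkPaths v : Set (List E)) :=
  (hF.totalOrderOn_postLt v).mono fun _ => (DirGraph.mem_sinkPaths hG).1

end IsFramed

end Framings

section RouteFlow

variable {V E : Type*} {G : DirGraph V E}

theorem DirGraph.IsSink.sum_out {K : Type*} [Fintype E] [AddCommMonoid K] {v : V}
    (hv : G.IsSink v) (f : E → K) : ∑ e with G.tail e = v, f e = 0 :=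
  Finset.sum_eq_zero fun e he => absurd (Finset.mem_filter.1 he).2 (hv e)

theorem DirGraph.IsSource.sum_in {K : Type*} [Fintype E] [AddCommMonoid K] {v : V}
    (hv : G.IsSource v) (f : E → K) : ∑ e with G.head e = v, f e = 0 :=
  Finset.sum_eq_zero fun e he => absurd (Finset.mem_filter.1 he).2 (hv e)

/-- The netflow vectors that are `0` or `1` at sources, nonpositive at sinks and zero elsewhere:
those of conservationist graphs and of augmentations. -/
structure IsUnitSupply (G : DirGraph V E) (b : V → ℤ) : Prop where
  source : ∀ i, G.IsSource i → b i = 0 ∨ b i = 1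
  sink : ∀ i, G.IsSink i → b i ≤ 0
  internal : ∀ i, G.IsInternal i → b i = 0

/-- The flow that sends the amount `c P` along each route `P`. -/
noncomputable def routeFlow (G : DirGraph V E) [Fintype G.Route] :
    (G.Route → ℝ) →ₗ[ℝ] E → ℝ :=
  Fintype.linearCombination ℝ fun P e => (P.edges.count e : ℝ)

theorem routeFlow_apply [Fintype G.Route] (c : G.Route → ℝ) (e : E) :
    routeFlow G c e = ∑ P : G.Route, P.edges.count e • c P := by
  simp [routeFlow, Fintype.linearCombination_apply, mul_comm]

/-- The weights `c` of the routes beginning at each source, and of those ending at each sink, add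
up to `t` times the absolute value of the netflow `b`, where `b` is nonnegative at sources and
nonpositive at sinks. -/
structure HasMarginals [Fintype G.Route] (b : V → ℤ) (t : ℝ) (c : G.Route → ℝ) : Prop where
  start : ∀ s, G.IsSource s → ∑ P : G.Route with P.start = s, c P = t * b s
  finish : ∀ v, G.IsSink v → ∑ P : G.Route with P.finish = v, c P = t * -b v

/-- A weight function on routes, supported on a route-clique, that induces the flow `f`. -/
structure IsCliqueDecomposition [Fintype G.Route] (b : V → ℤ) (F : FramingData V E)
    (f : E → ℝ) (c : G.Route → ℝ) : Prop where
  nonneg : ∀ P, 0 ≤ c P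
  clique : F.IsRouteClique {P | 0 < c P}
  flow : routeFlow G c = f
  marginals : HasMarginals b 1 c

end RouteFlow

section SuffixWeights

variable {V E : Type*} [Fintype E] {G : DirGraph V E} {b : V → ℤ} {F : FramingData V E}
  {f : E → ℝ} {w w' : V → List E → ℝ}

/-- At the vertex `v`, the weights `w (G.tail g) (g :: q)` of the paths that enter `v` along `g`
and continue along `q` couple the weights `w v q` with the flow `f g`. Their support is a chain
because routes in a clique do not cross at `v`. -/
def IsCoupledAt (hG : G.Acyclic) (F : FramingData V E) (f : E → ℝ) (w : V → List E → ℝ) (v : V) :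
    Prop :=
  IsChainCoupling F.PostLt (F.InOrder G) (hG.sinkPaths v) {g | G.head g = v} (w v) f
    fun q g => w (G.tail g) (g :: q)

/-- `w v q` behaves like the total weight of the routes that pass through `v` and continue along
`q`, in a decomposition of the flow `f` into the routes of a clique. -/
structure IsSuffixWeight (hG : G.Acyclic) (b : V → ℤ) (F : FramingData V E) (f : E → ℝ)
    (w : V → List E → ℝ) : Prop where
  nonneg : ∀ v, ∀ q ∈ hG.sinkPaths v, 0 ≤ w v q
  sink : ∀ v, G.IsSink v → w v [] = -b v
  source : ∀ s, G.IsSource s → ∑ q ∈ hG.sinkPaths s, w s q = b s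
  coupling : ∀ v, ¬ G.IsSource v → IsCoupledAt hG F f w v

theorem IsFramed.totalOrderOn_filter_head (hF : IsFramed G b F) (v : V) :
    TotalOrderOn (F.InOrder G) (Finset.univ.filter (G.head · = v) : Set E) :=
  (hF.totalOrderOn_inOrder v).mono fun _ he => (Finset.mem_filter.1 he).2

theorem IsSuffixWeight.unique [Finite V] (hG : G.Acyclic) (hF : IsFramed G b F)
    (hw : IsSuffixWeight hG b F f w) (hw' : IsSuffixWeight hG b F f w') (v : V) :
    ∀ q ∈ hG.sinkPaths v, w v q = w' v q := by
  induction v using hG.wellFounded_swap_reaches.induction with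
  | h v ih =>
    intro q hq
    rw [DirGraph.mem_sinkPaths] at hq
    cases q with
    | nil =>
      have hv := DirGraph.isSinkPath_nil.1 hq
      rw [hw.sink v hv, hw'.sink v hv]
    | cons g q =>
      obtain ⟨rfl, hq'⟩ := DirGraph.isSinkPath_cons.1 hq
      have hs : ¬ G.IsSource (G.head g) := fun h => h g rfl
      have hcoupling' := hw'.coupling _ hs
      have hrow : IsChainCoupling F.PostLt (F.InOrder G) (hG.sinkPaths (G.head g))
          {g' | G.head g' = G.head g} (w (G.head g)) f fun q g => w' (G.tail g) (g :: q) :=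
        { hcoupling' with
          row_sum := fun q hq =>
            (hcoupling'.row_sum q hq).trans (ih _ (DirGraph.reaches_edge g) q hq).symm }
      exact (hw.coupling _ hs).unique (hF.totalOrderOn_sinkPaths hG _)
        (hF.totalOrderOn_filter_head _) hrow q ((DirGraph.mem_sinkPaths hG).2 hq') g (by simp)

theorem IsCliqueDecomposition.isSuffixWeight [Fintype G.Route] {c : G.Route → ℝ}
    (hG : G.Acyclic) (hc : IsCliqueDecomposition b F f c) :
    IsSuffixWeight hG b F f fun v q => ∑ P : G.Route with P.HasSuffix v q, c P where
  nonneg _ _ _ := Finset.sum_nonneg fun P _ => hc.nonneg P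
  sink v hv := by
    simp_rw [DirGraph.Route.hasSuffix_nil, hc.marginals.finish v hv, one_mul]
  source s hs := by
    rw [DirGraph.sum_sinkPaths_sum_hasSuffix_of_isSource c hG hs, hc.marginals.start s hs, one_mul]
  coupling v hv :=
    { nonneg := fun _ _ _ _ => Finset.sum_nonneg fun P _ => hc.nonneg P
      row_sum := fun q _ => DirGraph.sum_sum_hasSuffix_cons c hv q
      col_sum := by
        intro g hg
        obtain rfl : G.head g = v := by simpa using hg
        rw [DirGraph.sum_sinkPaths_sum_hasSuffix_cons c hG, ← routeFlow_apply, hc.flow]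
      chain := by
        intro q hq q' _ g hg g' hg' hpost hin
        by_contra! hne
        obtain ⟨P, hP, hcP⟩ := Finset.exists_ne_zero_of_sum_ne_zero hne.1
        obtain ⟨Q, hQ, hcQ⟩ := Finset.exists_ne_zero_of_sum_ne_zero hne.2
        simp only [Finset.mem_filter, Finset.mem_univ, true_and] at hP hQ hg hg'
        have hsink := hpost.not_isSink ((DirGraph.mem_sinkPaths hG).1 hq)
        have hin' := (F.inOrder_iff (hg' ▸ hsink)).1 hin
        obtain ⟨i, hcross⟩ := F.exists_crossAt_iff.2
          ⟨g', g, q', q, hg'.trans hg.symm, hin'.1, hin'.2, hpost, hQ, hP⟩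
        exact (hc.clique Q ((hc.nonneg Q).lt_of_ne' hcQ) P ((hc.nonneg P).lt_of_ne' hcP) i).1
          hcross }

theorem IsCliqueDecomposition.unique {V E : Type*} [Finite V] [Finite E] {G : DirGraph V E}
    [Fintype G.Route] {b : V → ℤ} {F : FramingData V E} {f : E → ℝ} {c c' : G.Route → ℝ}
    (hG : G.Acyclic) (hF : IsFramed G b F) (hc : IsCliqueDecomposition b F f c)
    (hc' : IsCliqueDecomposition b F f c') : c = c' := by
  cases nonempty_fintype E
  funext P
  rw [← DirGraph.sum_hasSuffix_route c P, ← DirGraph.sum_hasSuffix_route c' P]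
  exact (hc.isSuffixWeight hG).unique hG hF (hc'.isSuffixWeight hG) _ _
    ((DirGraph.mem_sinkPaths hG).2 P.isSinkPath)

/-- The suffix weights of a flow, constructed from the sinks backwards: the incoming edges of each
vertex are coupled with the paths that leave it by the north-west corner rule. -/
noncomputable def greedyWeight [Finite V] (hG : G.Acyclic) (b : V → ℤ) (F : FramingData V E)
    (f : E → ℝ) : V → List E → ℝ :=
  hG.wellFounded_swap_reaches.fix fun v w q => match q with
    | [] => -b v
    | g :: q => if h : G.tail g = v then
        chainCoupling F.PostLt (F.InOrder G) (hG.sinkPaths (G.head g)) {g' | G.head g' = G.head g}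
          (w (G.head g) (h ▸ DirGraph.reaches_edge g)) f q g
      else 0

/-- The amount of flow that passes through a vertex, counted on the outgoing edges, or as the
demand at a sink. -/
noncomputable def throughput (G : DirGraph V E) (b : V → ℤ) (f : E → ℝ) (v : V) : ℝ :=
  if G.IsSink v then -b v else ∑ e with G.tail e = v, f e

theorem throughput_of_isSource (hf : f ∈ G.flowPolytope b) {s : V} (hs : G.IsSource s) :
    throughput G b f s = b s := by
  have hbal := hf.2 s
  rw [hs.sum_in, sub_zero] at hbal
  rw [throughput]
  split_ifs with hsink
  · rw [hsink.sum_out] at hbal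
    simp [← hbal]
  · exact hbal

theorem throughput_of_not_isSource (hb : IsUnitSupply G b) (hf : f ∈ G.flowPolytope b) {v : V}
    (hv : ¬ G.IsSource v) : throughput G b f v = ∑ e with G.head e = v, f e := by
  have hbal := hf.2 v
  rw [throughput]
  split_ifs with hsink
  · rw [hsink.sum_out] at hbal
    linarith
  · rw [hb.internal v ⟨hv, hsink⟩, Int.cast_zero] at hbal
    exact sub_eq_zero.1 hbal

section Greedy

variable [Finite V] (hG : G.Acyclic)

theorem greedyWeight_nil (v : V) : greedyWeight hG b F f v [] = -b v := by
  rw [greedyWeight, WellFounded.fix_eq]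

theorem greedyWeight_cons (g : E) (q : List E) :
    greedyWeight hG b F f (G.tail g) (g :: q) =
      chainCoupling F.PostLt (F.InOrder G) (hG.sinkPaths (G.head g)) {g' | G.head g' = G.head g}
        (greedyWeight hG b F f (G.head g)) f q g := by
  rw [greedyWeight, WellFounded.fix_eq]
  exact dif_pos rfl

variable (hb : IsUnitSupply G b) (hF : IsFramed G b F) (hf : f ∈ G.flowPolytope b)

include hb hF hf

theorem isCoupledAt_greedyWeight {v : V} (hv : ¬ G.IsSource v)
    (hnonneg : ∀ q ∈ hG.sinkPaths v, 0 ≤ greedyWeight hG b F f v q)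
    (htotal : ∑ q ∈ hG.sinkPaths v, greedyWeight hG b F f v q = throughput G b f v) :
    IsCoupledAt hG F f (greedyWeight hG b F f) v := by
  have hcoupling := isChainCoupling_chainCoupling (hF.totalOrderOn_sinkPaths hG v)
    (hF.totalOrderOn_filter_head v) hnonneg (fun e _ => hf.1 e)
    (htotal.trans (throughput_of_not_isSource hb hf hv))
  refine hcoupling.congr fun q _ g hg => ?_
  obtain rfl : G.head g = v := by simpa using hg
  exact greedyWeight_cons hG g q

theorem greedyWeight_nonneg_and_sum_eq_throughput (v : V) :
    (∀ q ∈ hG.sinkPaths v, 0 ≤ greedyWeight hG b F f v q) ∧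
      ∑ q ∈ hG.sinkPaths v, greedyWeight hG b F f v q = throughput G b f v := by
  induction v using hG.wellFounded_swap_reaches.induction with
  | h v ih =>
    by_cases hv : G.IsSink v
    · have hbv : (b v : ℝ) ≤ 0 := by exact_mod_cast hb.sink v hv
      simp [DirGraph.sinkPaths_of_isSink hG hv, greedyWeight_nil, throughput, hv, hbv]
    · have hcoupled (g : E) (hg : G.tail g = v) :
          IsCoupledAt hG F f (greedyWeight hG b F f) (G.head g) :=
        have ihg := ih _ (hg ▸ DirGraph.reaches_edge g)
        isCoupledAt_greedyWeight hG hb hF hf (fun h => h g rfl) ihg.1 ihg.2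
      constructor
      · rintro (_ | ⟨g, q⟩) hq <;> rw [DirGraph.mem_sinkPaths] at hq
        · exact absurd (DirGraph.isSinkPath_nil.1 hq) hv
        · obtain ⟨rfl, hq'⟩ := DirGraph.isSinkPath_cons.1 hq
          exact (hcoupled g rfl).nonneg q ((DirGraph.mem_sinkPaths hG).2 hq') g (by simp)
      · rw [throughput, if_neg hv, DirGraph.sum_sinkPaths_of_not_isSink hG hv]
        refine Finset.sum_congr rfl fun g hg => ?_
        obtain rfl : G.tail g = v := by simpa using hg
        exact (hcoupled g rfl).col_sum g (by simp)

theorem isSuffixWeight_greedyWeight : IsSuffixWeight hG b F f (greedyWeight hG b F f) :=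
  have h := greedyWeight_nonneg_and_sum_eq_throughput hG hb hF hf
  { nonneg := fun v => (h v).1
    sink := fun v _ => greedyWeight_nil hG v
    source := fun s hs => (h s).2.trans (throughput_of_isSource hf hs)
    coupling := fun v hv => isCoupledAt_greedyWeight hG hb hF hf hv (h v).1 (h v).2 }

end Greedy

namespace IsSuffixWeight

variable {hG : G.Acyclic}

theorem route_nonneg (hw : IsSuffixWeight hG b F f w) (P : G.Route) : 0 ≤ w P.start P.edges :=
  hw.nonneg _ _ ((DirGraph.mem_sinkPaths hG).2 P.isSinkPath)

variable [Finite V]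

theorem sum_hasSuffix [Fintype G.Route] (hw : IsSuffixWeight hG b F f w) (v : V) :
    ∀ q ∈ hG.sinkPaths v, ∑ P : G.Route with P.HasSuffix v q, w P.start P.edges = w v q := by
  induction v using hG.wellFounded_reaches.induction with
  | h v ih =>
    intro q hq
    by_cases hv : G.IsSource v
    · obtain ⟨t, ht, h⟩ := (DirGraph.mem_sinkPaths hG).1 hq
      exact DirGraph.sum_hasSuffix_route (fun P => w P.start P.edges) ⟨v, t, q, h, hv, ht⟩
    · rw [← DirGraph.sum_sum_hasSuffix_cons _ hv, ← (hw.coupling v hv).row_sum q hq]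
      refine Finset.sum_congr rfl fun g hg => ?_
      obtain rfl : G.head g = v := by simpa using hg
      exact ih _ (DirGraph.reaches_edge g) _ <| (DirGraph.mem_sinkPaths hG).2 <|
        DirGraph.isSinkPath_cons.2 ⟨rfl, (DirGraph.mem_sinkPaths hG).1 hq⟩

theorem pos_of_hasSuffix (hw : IsSuffixWeight hG b F f w) {P : G.Route} {v : V} {q : List E}
    (hP : 0 < w P.start P.edges) (hq : P.HasSuffix v q) : 0 < w v q := by
  have := DirGraph.Route.finite hG
  cases nonempty_fintype G.Route
  rw [← hw.sum_hasSuffix v q ((DirGraph.mem_sinkPaths hG).2 hq.isSinkPath)]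
  exact Finset.sum_pos' (fun Q _ => hw.route_nonneg Q) ⟨P, by simpa using hq, hP⟩

theorem not_crossAt (hw : IsSuffixWeight hG b F f w) {P Q : G.Route}
    (hP : 0 < w P.start P.edges) (hQ : 0 < w Q.start Q.edges) (i : V) : ¬ F.CrossAt i P Q := by
  intro hcross
  obtain ⟨e, g, p, q, hhead, hne, hin, hpost, hPe, hQg⟩ := F.exists_crossAt_iff.1 ⟨i, hcross⟩
  have hp : p ∈ hG.sinkPaths (G.head e) := (DirGraph.mem_sinkPaths hG).2 hPe.head.isSinkPath
  have hq : q ∈ hG.sinkPaths (G.head e) :=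
    (DirGraph.mem_sinkPaths hG).2 (hhead ▸ hQg.head.isSinkPath)
  have hsink := hpost.not_isSink ((DirGraph.mem_sinkPaths hG).1 hq)
  exact ((hw.coupling (G.head e) fun h => h e rfl).chain q hq p hp g (by simp [hhead]) e (by simp)
    hpost ((F.inOrder_iff hsink).2 ⟨hne, hin⟩)).elim
    (hw.pos_of_hasSuffix hQ hQg).ne' (hw.pos_of_hasSuffix hP hPe).ne'

theorem isCliqueDecomposition [Fintype G.Route] (hw : IsSuffixWeight hG b F f w) :
    IsCliqueDecomposition b F f fun P : G.Route => w P.start P.edges where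
  nonneg := hw.route_nonneg
  clique P hP Q hQ i := ⟨hw.not_crossAt hP hQ i, hw.not_crossAt hQ hP i⟩
  flow := by
    funext e
    rw [routeFlow_apply, ← DirGraph.sum_sinkPaths_sum_hasSuffix_cons _ hG,
      ← (hw.coupling (G.head e) fun h => h e rfl).col_sum e (by simp)]
    exact Finset.sum_congr rfl fun q hq => hw.sum_hasSuffix _ _ <| (DirGraph.mem_sinkPaths hG).2 <|
      DirGraph.isSinkPath_cons.2 ⟨rfl, (DirGraph.mem_sinkPaths hG).1 hq⟩
  marginals :=
    { start := fun s hs => by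
        rw [one_mul, ← hw.source s hs,
          ← DirGraph.sum_sinkPaths_sum_hasSuffix_of_isSource _ hG hs]
        exact Finset.sum_congr rfl (hw.sum_hasSuffix s)
      finish := fun v hv => by
        rw [one_mul, ← hw.sink v hv,
          ← hw.sum_hasSuffix v [] (by simp [DirGraph.isSinkPath_nil, hv])]
        simp_rw [DirGraph.Route.hasSuffix_nil] }

end IsSuffixWeight

theorem exists_isCliqueDecomposition [Finite V] [Fintype G.Route] (hG : G.Acyclic)
    (hb : IsUnitSupply G b) (hF : IsFramed G b F) (hf : f ∈ G.flowPolytope b) :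
    ∃ c : G.Route → ℝ, IsCliqueDecomposition b F f c :=
  ⟨_, (isSuffixWeight_greedyWeight hG hb hF hf).isCliqueDecomposition⟩

end SuffixWeights

section LayeringOrder

variable {V E : Type*} {G : DirGraph V E} {b : V → ℤ} {F : FramingData V E}
  {L M : Finset G.Route}

namespace IsLayering

theorem netflow_start (hb : IsUnitSupply G b) (hL : IsLayering G b L) {p : G.Route} (hp : p ∈ L) :
    b p.start = 1 := by
  refine (hb.source _ p.start_isSource).resolve_left fun h => ?_
  have hcard := hL.source _ p.start_isSource
  rw [h, Nat.cast_eq_zero, Finset.card_eq_zero, Finset.filter_eq_empty_iff] at hcard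
  exact hcard hp rfl

theorem existsUnique_route (hL : IsLayering G b L) {s : V} (hs : G.IsSource s) (hbs : b s = 1) :
    ∃! p, p ∈ L ∧ p.start = s := by
  simpa [hbs, Finset.card_eq_one_iff_existsUnique] using hL.source s hs

end IsLayering

/-- The edges of the route of the layering `L` that begins at `s`, the empty list if there is no
such route. -/
noncomputable def pathFrom (L : Finset G.Route) (s : V) : List E :=
  if h : ∃ p ∈ L, p.start = s then h.choose.edges else []

namespace IsLayering

theorem pathFrom_start (hb : IsUnitSupply G b) (hL : IsLayering G b L) {p : G.Route} (hp : p ∈ L) :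
    pathFrom L p.start = p.edges := by
  have h : ∃ q ∈ L, q.start = p.start := ⟨p, hp, rfl⟩
  rw [pathFrom, dif_pos h]
  exact congrArg _ <| (hL.existsUnique_route p.start_isSource (hL.netflow_start hb hp)).unique
    h.choose_spec ⟨hp, rfl⟩

theorem subset_of_pathFrom_eq (hb : IsUnitSupply G b) (hL : IsLayering G b L)
    (hM : IsLayering G b M) (h : ∀ s, G.IsSource s → b s = 1 → pathFrom L s = pathFrom M s) :
    L ⊆ M := by
  intro p hp
  have hbp := hL.netflow_start hb hp
  obtain ⟨q, ⟨hq, hqp⟩, -⟩ := hM.existsUnique_route p.start_isSource hbp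
  have hedges : p.edges = q.edges := by
    rw [← hL.pathFrom_start hb hp, ← hM.pathFrom_start hb hq, hqp]
    exact h _ p.start_isSource hbp
  exact DirGraph.Route.ext_of_edges hqp.symm hedges ▸ hq

theorem layeringLt_iff (hb : IsUnitSupply G b) (hL : IsLayering G b L) (hM : IsLayering G b M) :
    F.LayeringLt L M ↔ ∃ s : {s // G.IsSource s ∧ b s = 1},
      F.PostLt (pathFrom L s) (pathFrom M s) ∧
        ∀ s' : {s // G.IsSource s ∧ b s = 1}, F.srcLt s s' → pathFrom L s' = pathFrom M s' := by
  constructor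
  · rintro ⟨p, hp, q, hq, hpq, hlt, hmax⟩
    refine ⟨⟨p.start, p.start_isSource, hL.netflow_start hb hp⟩, ?_, ?_⟩
    · rw [← hL.pathFrom_start hb hp, ← hM.pathFrom_start hb hq, ← hpq] at hlt
      exact hlt
    · rintro ⟨s', hs', hbs'⟩ hlt'
      obtain ⟨p', ⟨hp', rfl⟩, -⟩ := hL.existsUnique_route hs' hbs'
      obtain ⟨q', ⟨hq', hqp'⟩, -⟩ := hM.existsUnique_route hs' hbs'
      obtain rfl := hmax p' hp' q' hq' hqp'.symm hlt'
      exact (hL.pathFrom_start hb hp').trans (hM.pathFrom_start hb hq').symm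
  · rintro ⟨⟨s, hs, hbs⟩, hlt, hmax⟩
    obtain ⟨p, ⟨hp, rfl⟩, -⟩ := hL.existsUnique_route hs hbs
    obtain ⟨q, ⟨hq, hqp⟩, -⟩ := hM.existsUnique_route hs hbs
    refine ⟨p, hp, q, hq, hqp.symm, ?_, fun p' hp' q' hq' hpq' hlt' => ?_⟩
    · rw [← hL.pathFrom_start hb hp, ← hM.pathFrom_start hb hq, hqp]
      exact hlt
    · have hpath := hmax ⟨p'.start, p'.start_isSource, hL.netflow_start hb hp'⟩ hlt'
      refine DirGraph.Route.ext_of_edges hpq' ?_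
      rw [← hL.pathFrom_start hb hp', ← hM.pathFrom_start hb hq', ← hpq']
      exact hpath

end IsLayering

theorem IsFramed.totalOrderOn_layeringLt [Finite V] (hF : IsFramed G b F)
    (hb : IsUnitSupply G b) : TotalOrderOn F.LayeringLt {L | IsLayering G b L} := by
  have hsrc : TotalOrderOn (fun s s' : {s // G.IsSource s ∧ b s = 1} => F.srcLt s s') Set.univ :=
    hF.src.of_iff_map (f := Subtype.val) (fun s _ => s.2) Subtype.val_injective.injOn
      fun _ _ _ _ => Iff.rfl
  refine (hsrc.lex fun s => hF.totalOrderOn_postLt s).of_iff_map (f := fun L s => pathFrom L s)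
    (fun L hL s _ => ?_) (fun L hL M hM h => ?_) fun L hL M hM => hL.layeringLt_iff hb hM
  · obtain ⟨p, ⟨hp, hps⟩, -⟩ := hL.existsUnique_route s.2.1 s.2.2
    change G.IsSinkPath s (pathFrom L s)
    rw [← hps, hL.pathFrom_start hb hp]
    exact p.isSinkPath
  · have hpath (s : V) (hs : G.IsSource s) (hbs : b s = 1) : pathFrom L s = pathFrom M s :=
      congrFun h ⟨s, hs, hbs⟩
    exact (hL.subset_of_pathFrom_eq hb hM hpath).antisymm
      (hM.subset_of_pathFrom_eq hb hL fun s hs hbs => (hpath s hs hbs).symm)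

end LayeringOrder

section IntegralTransport

theorem exists_bijective_forall_pos {S T : Type*} [Fintype S] [Fintype T] {M : S → T → ℝ} {t : ℝ}
    (ht : 0 < t) (hM : ∀ x y, 0 ≤ M x y) (hrow : ∀ x, ∑ y, M x y = t)
    (hcol : ∀ y, ∑ x, M x y = t) : ∃ f : S → T, Function.Bijective f ∧ ∀ x, 0 < M x (f x) := by
  have hcard : Fintype.card S = Fintype.card T := by
    have htotal : Fintype.card S * t = Fintype.card T * t := by
      simpa [hrow, hcol] using Finset.sum_comm (s := Finset.univ) (t := Finset.univ) (f := M)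
    exact_mod_cast mul_right_cancel₀ ht.ne' htotal
  let e := Fintype.equivOfCardEq hcard
  let D : Matrix S S ℝ := fun x x' => t⁻¹ * M x (e x')
  have hD : D ∈ doublyStochastic ℝ S := by
    refine mem_doublyStochastic_iff_sum.2
      ⟨fun x x' => mul_nonneg (inv_nonneg.2 ht.le) (hM _ _), fun x => ?_, fun x' => ?_⟩
    · rw [← Finset.mul_sum, e.sum_comp (M x), hrow, inv_mul_cancel₀ ht.ne']
    · rw [← Finset.mul_sum, hcol, inv_mul_cancel₀ ht.ne']
  obtain ⟨w, hw, hw_sum, hwD⟩ := exists_eq_sum_perm_of_mem_doublyStochastic hD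
  obtain ⟨σ, -, hσ⟩ := Finset.exists_ne_zero_of_sum_ne_zero (hw_sum.trans_ne one_ne_zero)
  refine ⟨e ∘ σ, e.bijective.comp σ.bijective, fun x => (hM _ _).lt_of_ne' fun h => hσ ?_⟩
  have hzero : ∑ π, w π * π.permMatrix ℝ x (σ x) = 0 := by
    have hDx : D x (σ x) = 0 := (congrArg (t⁻¹ * ·) h).trans (mul_zero _)
    simpa only [Matrix.sum_apply, Matrix.smul_apply, smul_eq_mul, hDx] using
      congrFun (congrFun hwD x) (σ x)
  have hterm := (Finset.sum_eq_zero_iff_of_nonneg fun π _ => mul_nonneg (hw π) ?_).1 hzero σ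
    (Finset.mem_univ σ)
  · simpa [Equiv.Perm.permMatrix] using hterm
  · simp only [Equiv.Perm.permMatrix, PEquiv.toMatrix_apply]
    split_ifs <;> norm_num

theorem card_filter_sigma_fst {σ : Type*} [Fintype σ] (m : σ → ℕ) (s : σ) :
    (Finset.univ.filter fun x : Σ s, Fin (m s) => x.1 = s).card = m s := by
  rw [← Fintype.card_subtype, Fintype.card_congr (Equiv.sigmaSubtype s), Fintype.card_fin]

variable {ι σ τ : Type*} [Fintype ι] {start : ι → σ} {finish : ι → τ} {c : ι → ℝ} {t : ℝ}
  {m : σ → ℕ} {d : τ → ℕ}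

theorem sum_sigma_sum_div [Fintype τ] (hc : ∀ P, 0 ≤ c P) {s : σ} {k : ℕ} (hk : k ≠ 0)
    (hstart : ∑ P with start P = s, c P = t * k)
    (hfinish : ∀ v, ∑ P with finish P = v, c P = t * d v) :
    ∑ y : Σ v, Fin (d v), (∑ P with start P = s ∧ finish P = y.1, c P) / (k * d y.1) = t := by
  have hfibre (v : τ) : d v * ((∑ P with start P = s ∧ finish P = v, c P) / (k * d v)) =
      (∑ P with start P = s ∧ finish P = v, c P) / k := by
    rcases eq_or_ne (d v) 0 with hv | hv
    · have hzero : ∀ P, finish P = v → c P = 0 := by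
        simpa [hv, Finset.sum_eq_zero_iff_of_nonneg fun P _ => hc P] using hfinish v
      rw [Finset.sum_eq_zero fun P hP => hzero P (Finset.mem_filter.1 hP).2.2]
      simp
    · field_simp
  rw [Fintype.sum_sigma]
  simp only [Finset.sum_const, Finset.card_univ, Fintype.card_fin, nsmul_eq_mul, hfibre]
  rw [← Finset.sum_div, div_eq_iff (Nat.cast_ne_zero.2 hk), ← hstart,
    ← Finset.sum_fiberwise _ finish c]
  simp_rw [Finset.filter_filter]

/-- If the marginals of `c` are integral up to a common factor, then they are those of a multiset
up to that factor. -/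
theorem exists_multiset_countP_eq [Finite σ] [Finite τ] (ht : 0 < t) (hc : ∀ P, 0 ≤ c P)
    (hstart : ∀ s, ∑ P with start P = s, c P = t * m s)
    (hfinish : ∀ v, ∑ P with finish P = v, c P = t * d v) :
    ∃ L : Multiset ι, (∀ P ∈ L, 0 < c P) ∧ (∀ s, L.countP (start · = s) = m s) ∧
      ∀ v, L.countP (finish · = v) = d v := by
  cases nonempty_fintype σ
  cases nonempty_fintype τ
  let M (x : Σ s, Fin (m s)) (y : Σ v, Fin (d v)) : ℝ :=
    (∑ P with start P = x.1 ∧ finish P = y.1, c P) / (m x.1 * d y.1)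
  obtain ⟨f, hf, hfM⟩ := exists_bijective_forall_pos (M := M) ht
    (fun x y => div_nonneg (Finset.sum_nonneg fun P _ => hc P) (by positivity))
    (fun x => sum_sigma_sum_div hc x.2.pos.ne' (hstart _) hfinish)
    (fun y => by
      simpa only [M, and_comm, mul_comm] using sum_sigma_sum_div hc y.2.pos.ne' (hfinish _) hstart)
  have hroute (x : Σ s, Fin (m s)) : ∃ P, 0 < c P ∧ start P = x.1 ∧ finish P = (f x).1 := by
    have hne : ∑ P with start P = x.1 ∧ finish P = (f x).1, c P ≠ 0 := fun h => by
      simpa [M, h] using hfM x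
    obtain ⟨P, hP, hcP⟩ := Finset.exists_ne_zero_of_sum_ne_zero hne
    exact ⟨P, (hc P).lt_of_ne' hcP, (Finset.mem_filter.1 hP).2⟩
  choose P hcP hPstart hPfinish using hroute
  refine ⟨Finset.univ.val.map P, ?_, fun s => ?_, fun v => ?_⟩
  · intro Q hQ
    obtain ⟨x, -, rfl⟩ := Multiset.mem_map.1 hQ
    exact hcP x
  · simp_rw [Multiset.countP_map, hPstart]
    exact card_filter_sigma_fst m s
  · simp_rw [Multiset.countP_map, hPfinish]
    exact (Finset.card_bijective (s := {x | (f x).1 = v}) (t := {y | y.1 = v}) f hf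
      (by simp)).trans (card_filter_sigma_fst d v)

end IntegralTransport

theorem HasMarginals.exists_isLayering {V E : Type*} [Finite V] {G : DirGraph V E}
    [Fintype G.Route] {b : V → ℤ} {t : ℝ} {c : G.Route → ℝ} (hb : IsUnitSupply G b) (ht : 0 < t)
    (hc : ∀ P, 0 ≤ c P) (h : HasMarginals b t c) :
    ∃ L, IsLayering G b L ∧ ∀ P ∈ L, 0 < c P := by
  let m (s : V) : ℕ := if G.IsSource s then (b s).natAbs else 0
  let d (v : V) : ℕ := if G.IsSink v then (b v).natAbs else 0
  have hstart (s : V) : ∑ P : G.Route with P.start = s, c P = t * m s := by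
    by_cases hs : G.IsSource s
    · have hbs : (b s).natAbs = b s := by rcases hb.source s hs with h | h <;> simp [h]
      rw [h.start s hs, ← hbs]
      simp [m, hs]
    · have hne (P : G.Route) : P.start ≠ s := fun hP => hs (hP ▸ P.start_isSource)
      simp [m, hs, hne]
  have hfinish (v : V) : ∑ P : G.Route with P.finish = v, c P = t * d v := by
    by_cases hv : G.IsSink v
    · have hbv : ((b v).natAbs : ℤ) = -b v := Int.ofNat_natAbs_of_nonpos (hb.sink v hv)
      rw [h.finish v hv, ← Int.cast_neg, ← hbv]
      simp [d, hv]
    · have hne (P : G.Route) : P.finish ≠ v := fun hP => hv (hP ▸ P.finish_isSink)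
      simp [d, hv, hne]
  obtain ⟨L, hLc, hLstart, hLfinish⟩ := exists_multiset_countP_eq ht hc hstart hfinish
  have hnodup : L.Nodup := Multiset.nodup_iff_count_le_one.2 fun P => by
    have hle : L.count P ≤ L.countP (·.start = P.start) := by
      rw [Multiset.count, Multiset.countP_eq_card_filter, Multiset.countP_eq_card_filter]
      exact Multiset.card_le_card <| Multiset.monotone_filter_right L fun Q hQ => hQ ▸ rfl
    refine hle.trans ((hLstart _).trans_le ?_)
    rcases hb.source _ P.start_isSource with h | h <;> simp [m, h, P.start_isSource]
  refine ⟨⟨L, hnodup⟩, ⟨fun s hs => ?_, fun v hv => ?_⟩, hLc⟩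
  · have hcount := (Multiset.countP_eq_card_filter _ L).symm.trans (hLstart s)
    refine (congrArg Nat.cast hcount).trans ?_
    rcases hb.source s hs with h | h <;> simp [m, h, hs]
  · have hcount := (Multiset.countP_eq_card_filter _ L).symm.trans (hLfinish v)
    refine (congrArg Nat.cast hcount).trans ?_
    simp [d, hv]

section LayerSum

/-- The indices at which the weight function `μ` is positive. -/
noncomputable def posSupport {ι : Type*} [Fintype ι] (μ : ι → ℝ) : Finset ι :=
  Finset.univ.filter (0 < μ ·)

theorem mem_posSupport {ι : Type*} [Fintype ι] {μ : ι → ℝ} {i : ι} :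
    i ∈ posSupport μ ↔ 0 < μ i := by
  simp [posSupport]

variable {V E : Type*} {G : DirGraph V E} [Fintype G.Route]

/-- The weights on routes induced by weights on layerings: every layering passes its weight on to
each of its routes. -/
noncomputable def layerSum (G : DirGraph V E) [Fintype G.Route] :
    (Finset G.Route → ℝ) →ₗ[ℝ] G.Route → ℝ :=
  Fintype.linearCombination ℝ fun L P => if P ∈ L then 1 else 0

theorem layerSum_apply (μ : Finset G.Route → ℝ) (P : G.Route) :
    layerSum G μ P = ∑ L with P ∈ L, μ L := by
  simp [layerSum, Fintype.linearCombination_apply, Finset.sum_filter]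

theorem layerSum_single (L : Finset G.Route) (t : ℝ) (P : G.Route) :
    layerSum G (Pi.single L t) P = if P ∈ L then t else 0 := by
  simp [layerSum, Fintype.linearCombination_apply_single]

theorem layerSum_nonneg {μ : Finset G.Route → ℝ} (hμ : 0 ≤ μ) (P : G.Route) :
    0 ≤ layerSum G μ P :=
  (Finset.sum_nonneg fun L _ => hμ L).trans_eq (layerSum_apply μ P).symm

theorem layerSum_pos_iff {μ : Finset G.Route → ℝ} (hμ : 0 ≤ μ) {P : G.Route} :
    0 < layerSum G μ P ↔ P ∈ routes {L | L ∈ posSupport μ} := by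
  rw [layerSum_apply, Finset.sum_pos_iff_of_nonneg fun L _ => hμ L]
  simp [routes, mem_posSupport, and_comm]

theorem sum_filter_layerSum (μ : Finset G.Route → ℝ) (p : G.Route → Prop) :
    ∑ P with p P, layerSum G μ P = ∑ L, μ L * (L.filter p).card := by
  simp_rw [layerSum_apply, Finset.sum_filter (p := fun L => _ ∈ L)]
  rw [Finset.sum_comm]
  refine Finset.sum_congr rfl fun L _ => ?_
  rw [← Finset.sum_filter, Finset.sum_const, nsmul_eq_mul, mul_comm, Finset.filter_filter]
  congr 3
  ext P
  simp [and_comm]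

theorem hasMarginals_layerSum {b : V → ℤ} (hb : IsUnitSupply G b)
    {μ : Finset G.Route → ℝ}
    (hμ : ∀ L, μ L ≠ 0 → IsLayering G b L) :
    HasMarginals b (∑ L, μ L) (layerSum G μ) where
  start s hs := by
    rw [sum_filter_layerSum, Finset.sum_mul]
    refine Finset.sum_congr rfl fun L _ => ?_
    rcases eq_or_ne (μ L) 0 with hL | hL
    · simp [hL]
    · rw [← (hμ L hL).source s hs, Int.cast_natCast]
  finish v hv := by
    rw [sum_filter_layerSum, Finset.sum_mul]
    refine Finset.sum_congr rfl fun L _ => ?_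
    rcases eq_or_ne (μ L) 0 with hL | hL
    · simp [hL]
    · rw [← Int.cast_neg, ← abs_of_nonpos (hb.sink v hv), ← (hμ L hL).sink v hv, Int.cast_natCast]

namespace HasMarginals

variable {b : V → ℤ} {c c' : G.Route → ℝ} {t t' : ℝ}

theorem sub (h : HasMarginals b t c) (h' : HasMarginals b t' c') :
    HasMarginals b (t - t') (c - c') where
  start s hs := by
    simp only [Pi.sub_apply, Finset.sum_sub_distrib, h.start s hs, h'.start s hs, sub_mul]
  finish v hv := by
    simp only [Pi.sub_apply, Finset.sum_sub_distrib, h.finish v hv, h'.finish v hv, sub_mul]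

theorem eq_of_ne_zero (hb : IsUnitSupply G b) (hb0 : b ≠ 0) (h : HasMarginals b t c)
    (h' : HasMarginals b t' c) : t = t' := by
  obtain ⟨i, hi⟩ := Function.ne_iff.1 hb0
  have hi' : (b i : ℝ) ≠ 0 := Int.cast_ne_zero.2 hi
  by_cases hs : G.IsSource i
  · exact mul_right_cancel₀ hi' ((h.start i hs).symm.trans (h'.start i hs))
  · have hv : G.IsSink i := by
      by_contra hv
      exact hi (hb.internal i ⟨hs, hv⟩)
    exact mul_right_cancel₀ (neg_ne_zero.2 hi') ((h.finish i hv).symm.trans (h'.finish i hv))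

theorem pos_of_pos (hb : IsUnitSupply G b) (h : HasMarginals b t c) (hc : ∀ P, 0 ≤ c P)
    {P : G.Route} (hP : 0 < c P) : 0 < t ∧ b P.start = 1 := by
  have hpos : 0 < t * b P.start := by
    rw [← h.start _ P.start_isSource]
    exact Finset.sum_pos' (fun Q _ => hc Q) ⟨P, by simp, hP⟩
  rcases hb.source _ P.start_isSource with hs | hs
  · simp [hs] at hpos
  · exact ⟨by simpa [hs] using hpos, hs⟩

end HasMarginals

end LayerSum

section LayeringSimplex

variable {V E : Type*} {G : DirGraph V E} {b : V → ℤ} {F : FramingData V E}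
  {𝓛 𝓜 : Finset (Finset G.Route)} {L : Finset G.Route}

namespace IsLayeringSimplex

theorem subset (h : IsLayeringSimplex G b F 𝓛) (hs : 𝓜 ⊆ 𝓛) : IsLayeringSimplex G b F 𝓜 where
  layering L hL := h.layering L (hs hL)
  clique := fun p ⟨L, hL, hp⟩ q ⟨M, hM, hq⟩ => h.clique p ⟨L, hs hL, hp⟩ q ⟨M, hs hM, hq⟩
  least L hL M hM hr := h.least L (hs hL) M hM fun p hp =>
    let ⟨K, hK, hpK⟩ := hr p hp
    ⟨K, ⟨hs hK.1, hK.2⟩, hpK⟩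
  newRoute L hL :=
    let ⟨p, hp, hn⟩ := h.newRoute L (hs hL)
    ⟨p, hp, fun ⟨K, hK, hpK⟩ => hn ⟨K, ⟨hs hK.1, hK.2⟩, hpK⟩⟩

theorem empty : IsLayeringSimplex G b F ∅ where
  layering := by simp
  clique := fun p ⟨L, hL, _⟩ => absurd hL (Finset.notMem_empty L)
  least := by simp
  newRoute := by simp

theorem insert_least (hO : TotalOrderOn F.LayeringLt {L | IsLayering G b L})
    (h : IsLayeringSimplex G b F 𝓛) (hL : IsLayering G b L) (hlt : ∀ K ∈ 𝓛, F.LayeringLt L K)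
    (hclique : F.IsRouteClique (routes {K | K ∈ insert L 𝓛}))
    (hleast : ∀ M, IsLayering G b M → (∀ p ∈ M, p ∈ routes {K | K ∈ insert L 𝓛}) →
      L = M ∨ F.LayeringLt L M)
    (hnew : ∃ p ∈ L, p ∉ routes {K | K ∈ 𝓛}) : IsLayeringSimplex G b F (insert L 𝓛) := by
  have hirrefl : ¬ F.LayeringLt L L := hO.irrefl L hL
  have hnot_lt (K) (hK : K ∈ 𝓛) : ¬ F.LayeringLt K L := hO.asymm hL (h.layering K hK) (hlt K hK)
  have hne (K) (hK : K ∈ 𝓛) : L ≠ K := fun hLK => hirrefl (hLK ▸ hlt K hK)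
  refine ⟨Finset.forall_mem_insert .. |>.2 ⟨hL, h.layering⟩, hclique,
    Finset.forall_mem_insert .. |>.2 ⟨fun M hM hr => hleast M hM fun p hp => ?_,
      fun K hK M hM hr => h.least K hK M hM fun p hp => ?_⟩,
    Finset.forall_mem_insert .. |>.2 ⟨?_, fun K hK => ?_⟩⟩
  · obtain ⟨N, hN, hpN⟩ := hr p hp
    exact ⟨N, hN.1, hpN⟩
  · obtain ⟨N, ⟨hN, hKN⟩, hpN⟩ := hr p hp
    refine ⟨N, ⟨Finset.mem_of_mem_insert_of_ne hN ?_, hKN⟩, hpN⟩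
    rintro rfl
    exact hKN.elim (hne K hK) (hnot_lt K hK)
  · obtain ⟨p, hp, hpn⟩ := hnew
    refine ⟨p, hp, fun ⟨N, ⟨hN, hLN⟩, hpN⟩ => hpn ⟨N, Finset.mem_of_mem_insert_of_ne hN ?_, hpN⟩⟩
    rintro rfl
    exact hirrefl hLN
  · obtain ⟨p, hp, hpn⟩ := h.newRoute K hK
    refine ⟨p, hp, fun ⟨N, ⟨hN, hKN⟩, hpN⟩ =>
      hpn ⟨N, ⟨Finset.mem_of_mem_insert_of_ne hN ?_, hKN⟩, hpN⟩⟩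
    rintro rfl
    exact hnot_lt K hK hKN

end IsLayeringSimplex

end LayeringSimplex

section WeightFrom

variable {V E : Type*} {G : DirGraph V E} [Fintype G.Route] {b : V → ℤ} {F : FramingData V E}
  {μ ν : Finset G.Route → ℝ} {L M : Finset G.Route} {P : G.Route}

/-- The total weight that the layerings from `L` on pass to the route `P`. -/
noncomputable def weightFrom (F : FramingData V E) (μ : Finset G.Route → ℝ) (L : Finset G.Route)
    (P : G.Route) : ℝ :=
  ∑ K with P ∈ K ∧ (K = L ∨ F.LayeringLt L K), μ K

theorem weightFrom_pos_iff (hμ : 0 ≤ μ) :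
    0 < weightFrom F μ L P ↔
      P ∈ routes {K | K ∈ posSupport μ ∧ (K = L ∨ F.LayeringLt L K)} := by
  rw [weightFrom, Finset.sum_pos_iff_of_nonneg fun K _ => hμ K]
  simp only [Finset.mem_filter, Finset.mem_univ, true_and, routes, mem_posSupport,
    Set.mem_ofPred_eq]
  exact exists_congr fun K => by tauto

theorem le_weightFrom (hμ : 0 ≤ μ) (hP : P ∈ L) : μ L ≤ weightFrom F μ L P :=
  Finset.single_le_sum (fun K _ => hμ K) (by simp [hP])

theorem exists_weightFrom_eq (hμ : 0 ≤ μ) (h : IsLayeringSimplex G b F (posSupport μ))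
    (hL : 0 < μ L) : ∃ P ∈ L, weightFrom F μ L P = μ L := by
  obtain ⟨P, hP, hnew⟩ := h.newRoute L (mem_posSupport.2 hL)
  refine ⟨P, hP, Finset.sum_eq_single_of_mem L (by simp [hP]) fun K hK hKL => ?_⟩
  obtain ⟨hPK, hLK⟩ := (Finset.mem_filter.1 hK).2
  by_contra hK0
  exact hnew ⟨K, ⟨mem_posSupport.2 ((hμ K).lt_of_ne' hK0), hLK.resolve_left hKL⟩, hPK⟩

theorem weightFrom_eq_of_layerSum_eq (h : layerSum G μ = layerSum G ν)
    (hL : ∀ K, μ K ≠ ν K → L = K ∨ F.LayeringLt L K) (P : G.Route) :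
    weightFrom F μ L P = weightFrom F ν L P := by
  rw [← sub_eq_zero, weightFrom, weightFrom, ← Finset.sum_sub_distrib, ← Finset.filter_filter]
  rw [Finset.sum_filter_of_ne fun K _ hK => (hL K (sub_ne_zero.1 hK)).imp_left Eq.symm,
    Finset.sum_sub_distrib, ← layerSum_apply, ← layerSum_apply, h, sub_self]

/-- By `least`, the first layering of the support of `ν` from `L` on is the least layering among
the routes of positive weight, and `L` competes for that. -/
theorem pos_of_weightFrom_eq (hO : TotalOrderOn F.LayeringLt {L | IsLayering G b L})
    (hμ : 0 ≤ μ) (hν : 0 ≤ ν) (h : IsLayeringSimplex G b F (posSupport ν))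
    (hL : IsLayering G b L) (hne : L.Nonempty) (hμL : 0 < μ L)
    (heq : ∀ P, weightFrom F μ L P = weightFrom F ν L P) : 0 < ν L := by
  have hroutes : ∀ P ∈ L,
      P ∈ routes {K | K ∈ posSupport ν ∧ (K = L ∨ F.LayeringLt L K)} := fun P hP =>
    (weightFrom_pos_iff hν).1 ((hμL.trans_le (le_weightFrom hμ hP)).trans_eq (heq P))
  obtain ⟨P, hP⟩ := hne
  obtain ⟨K, hK, -⟩ := hroutes P hP
  obtain ⟨M, ⟨hM, hLM⟩, hleast⟩ := (hO.mono fun K hK => h.layering K hK.1).exists_least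
    (Set.toFinite _) ⟨K, hK⟩
  have hML : M = L ∨ F.LayeringLt M L := h.least M hM L hL fun Q hQ =>
    let ⟨N, hN, hQN⟩ := hroutes Q hQ
    ⟨N, ⟨hN.1, (hleast N hN).imp_left Eq.symm⟩, hQN⟩
  suffices M = L from mem_posSupport.1 (this ▸ hM)
  rcases hLM with hLM | hLM
  · exact hLM
  · exact hML.resolve_right (hO.asymm hL (h.layering M hM) hLM)

theorem le_of_weightFrom_eq (hO : TotalOrderOn F.LayeringLt {L | IsLayering G b L})
    (hμ : 0 ≤ μ) (hν : 0 ≤ ν) (h : IsLayeringSimplex G b F (posSupport μ))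
    (h' : IsLayeringSimplex G b F (posSupport ν))
    (heq : ∀ P, weightFrom F μ L P = weightFrom F ν L P) : μ L ≤ ν L := by
  rcases (hμ L).eq_or_lt with hL | hL
  · exact hL.symm.trans_le (hν L)
  · have hLS := mem_posSupport.2 hL
    obtain ⟨P, hP, -⟩ := h.newRoute L hLS
    have hνL := pos_of_weightFrom_eq hO hμ hν h' (h.layering L hLS) ⟨P, hP⟩ hL heq
    obtain ⟨Q, hQ, hQν⟩ := exists_weightFrom_eq hν h' hνL
    exact (le_weightFrom hμ hQ).trans_eq ((heq Q).trans hQν)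

theorem IsLayeringSimplex.eq_of_layerSum_eq (hO : TotalOrderOn F.LayeringLt {L | IsLayering G b L})
    (hμ : 0 ≤ μ) (hν : 0 ≤ ν) (h : IsLayeringSimplex G b F (posSupport μ))
    (h' : IsLayeringSimplex G b F (posSupport ν)) (heq : layerSum G μ = layerSum G ν) :
    μ = ν := by
  by_contra hne
  have hlayering : ∀ K ∈ {K | μ K ≠ ν K}, IsLayering G b K := by
    intro K hK
    rcases (hμ K).eq_or_lt with hK0 | hK0
    · exact h'.layering K (mem_posSupport.2 ((hν K).lt_of_ne fun h0 => hK (hK0.symm.trans h0)))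
    · exact h.layering K (mem_posSupport.2 hK0)
  obtain ⟨L, hL, hleast⟩ := (hO.mono hlayering).exists_least (Set.toFinite _)
    (Function.ne_iff.1 hne)
  have hweight := weightFrom_eq_of_layerSum_eq heq hleast
  exact hL <| (le_of_weightFrom_eq hO hμ hν h h' hweight).antisymm
    (le_of_weightFrom_eq hO hν hμ h' h fun P => (hweight P).symm)

end WeightFrom

section Peeling

variable {V E : Type*} {G : DirGraph V E} [Fintype G.Route] {b : V → ℤ} {F : FramingData V E}
  {c : G.Route → ℝ} {t ε : ℝ} {μ : Finset G.Route → ℝ} {L : Finset G.Route}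

theorem posSupport_add_single (hμ : 0 ≤ μ) (L : Finset G.Route) (hε : 0 < ε) :
    posSupport (μ + Pi.single L ε) = insert L (posSupport μ) := by
  ext K
  rw [mem_posSupport, Finset.mem_insert, mem_posSupport, Pi.add_apply]
  rcases eq_or_ne K L with rfl | hK
  · simpa using add_pos_of_nonneg_of_pos (hμ K) hε
  · simp [hK]

theorem IsLayeringSimplex.add_single
    (hO : TotalOrderOn F.LayeringLt {L | IsLayering G b L})
    (h : IsLayeringSimplex G b F (posSupport μ)) (hμ : 0 ≤ μ) (hε : 0 < ε) (hL : IsLayering G b L)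
    (hclique : F.IsRouteClique {P | 0 < layerSum G (μ + Pi.single L ε) P})
    (hleast : ∀ M, IsLayering G b M → (∀ P ∈ M, 0 < layerSum G (μ + Pi.single L ε) P) →
      L = M ∨ F.LayeringLt L M)
    (hnew : ∃ P ∈ L, layerSum G μ P = 0) :
    IsLayeringSimplex G b F (posSupport (μ + Pi.single L ε)) := by
  have hμε : 0 ≤ μ + Pi.single L ε := add_nonneg hμ (Pi.single_nonneg.2 hε.le)
  have hpos (P : G.Route) : 0 < layerSum G (μ + Pi.single L ε) P ↔
      P ∈ routes {K | K ∈ insert L (posSupport μ)} := by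
    rw [layerSum_pos_iff hμε, posSupport_add_single hμ L hε]
  obtain ⟨P₀, hP₀, hzero⟩ := hnew
  have hP₀_new : P₀ ∉ routes {K | K ∈ posSupport μ} := fun hP =>
    ((layerSum_pos_iff hμ).2 hP).ne' hzero
  rw [posSupport_add_single hμ L hε]
  refine h.insert_least hO hL (fun K hK => ?_)
    (fun P hP Q hQ => hclique P ((hpos P).2 hP) Q ((hpos Q).2 hQ))
    (fun M hM hr => hleast M hM fun P hP => (hpos P).2 (hr P hP)) ⟨P₀, hP₀, hP₀_new⟩
  refine (hleast K (h.layering K hK) fun P hP =>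
    (hpos P).2 ⟨K, Finset.mem_insert_of_mem hK, hP⟩).resolve_left ?_
  rintro rfl
  exact hP₀_new ⟨L, hK, hP₀⟩

variable [Finite V]

theorem HasMarginals.exists_least_isLayering (hb : IsUnitSupply G b)
    (hO : TotalOrderOn F.LayeringLt {L | IsLayering G b L}) (h : HasMarginals b t c)
    (hc : ∀ P, 0 ≤ c P) (ht : 0 < t) :
    ∃ L, IsLayering G b L ∧ (∀ P ∈ L, 0 < c P) ∧
      ∀ M, IsLayering G b M → (∀ P ∈ M, 0 < c P) → L = M ∨ F.LayeringLt L M := by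
  let S : Set (Finset G.Route) := {L | IsLayering G b L ∧ ∀ P ∈ L, 0 < c P}
  obtain ⟨L, hL, hleast⟩ := (hO.mono (t := S) fun _ hL => hL.1).exists_least (Set.toFinite _)
    (h.exists_isLayering hb ht hc)
  exact ⟨L, hL.1, hL.2, fun M hM hMc => hleast M ⟨hM, hMc⟩⟩

/-- Peeling off the least layering `L` among the routes of positive weight, with the greatest
possible weight, removes a route of `L` from the support. -/
theorem HasMarginals.exists_layerSum_eq (hb : IsUnitSupply G b)
    (hO : TotalOrderOn F.LayeringLt {L | IsLayering G b L}) (h : HasMarginals b t c)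
    (hc : ∀ P, 0 ≤ c P) (hclique : F.IsRouteClique {P | 0 < c P}) :
    ∃ μ, 0 ≤ μ ∧ IsLayeringSimplex G b F (posSupport μ) ∧ layerSum G μ = c := by
  induction hn : (posSupport c).card using Nat.strong_induction_on generalizing c t with
  | _ n ih =>
  by_cases hc0 : c = 0
  · exact ⟨0, le_rfl, by simpa [posSupport] using IsLayeringSimplex.empty, by simp [hc0]⟩
  obtain ⟨P, hP⟩ := Function.ne_iff.1 hc0
  obtain ⟨ht, hbP⟩ := h.pos_of_pos hb hc ((hc P).lt_of_ne' hP)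
  obtain ⟨L, hL, hLc, hleast⟩ := h.exists_least_isLayering hb hO hc ht
  obtain ⟨Q, ⟨hQ, -⟩, -⟩ := hL.existsUnique_route P.start_isSource hbP
  obtain ⟨P₀, hP₀, hmin⟩ := L.exists_min_image c ⟨Q, hQ⟩
  let δ : Finset G.Route → ℝ := Pi.single L (c P₀)
  let c' := c - layerSum G δ
  have hc'_apply (P : G.Route) : c' P = c P - if P ∈ L then c P₀ else 0 := by
    simp [c', δ, layerSum_single]
  have hc' (P : G.Route) : 0 ≤ c' P := by
    rw [hc'_apply]
    split_ifs with hPL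
    · exact sub_nonneg.2 (hmin P hPL)
    · simpa using hc P
  have hc'c (P : G.Route) (hP : 0 < c' P) : 0 < c P := by
    rw [hc'_apply] at hP
    split_ifs at hP <;> linarith [hc P₀]
  have hc'P₀ : c' P₀ = 0 := by simp [hc'_apply, hP₀]
  have hcard : (posSupport c').card < n := hn ▸ Finset.card_lt_card
    (Finset.ssubset_iff_of_subset (fun P hP => mem_posSupport.2 (hc'c P (mem_posSupport.1 hP)))
      |>.2 ⟨P₀, mem_posSupport.2 (hLc P₀ hP₀), fun h => (mem_posSupport.1 h).ne' hc'P₀⟩)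
  have hδ : ∀ K, δ K ≠ 0 → IsLayering G b K := fun K hK =>
    (of_not_not fun hKL => hK (Pi.single_eq_of_ne hKL _) : K = L) ▸ hL
  obtain ⟨μ, hμ, hsimplex, hμc⟩ := ih _ hcard (h.sub (hasMarginals_layerSum hb hδ)) hc'
    (fun x hx y hy => hclique x (hc'c x hx) y (hc'c y hy)) rfl
  have hsum : layerSum G (μ + Pi.single L (c P₀)) = c := by
    rw [map_add, hμc, sub_add_cancel]
  exact ⟨μ + δ, add_nonneg hμ (Pi.single_nonneg.2 (hc P₀)),
    hsimplex.add_single hO hμ (hLc P₀ hP₀) hL (by rwa [hsum])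
      (by rwa [hsum]) ⟨P₀, hP₀, hμc ▸ hc'P₀⟩, hsum⟩

end Peeling

section Triangulation

variable {ι W : Type*} [Fintype ι]

theorem isClosed_setOf_posSupport_mem {K : Set (Finset ι)} (hK : IsLowerSet K) :
    IsClosed {μ : ι → ℝ | posSupport μ ∈ K} := by
  rw [← isOpen_compl_iff, isOpen_iff_mem_nhds]
  intro μ hμ
  have hopen : IsOpen {ν : ι → ℝ | ∀ i ∈ posSupport μ, 0 < ν i} := by
    simp only [Set.ofPred_forall]
    exact isOpen_biInter_finset fun i _ => isOpen_lt continuous_const (continuous_apply i)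
  filter_upwards [hopen.mem_nhds fun i hi => mem_posSupport.1 hi] with ν hν hνK
  exact hμ (hK (fun i hi => mem_posSupport.2 (hν i hi)) hνK)

theorem exists_mem_stdSimplex_posSupport_eq {σ : Finset ι} (hσ : σ.Nonempty) :
    ∃ μ ∈ stdSimplex ℝ ι, posSupport μ = σ := by
  have hcard : (0 : ℝ) < σ.card := Nat.cast_pos.2 hσ.card_pos
  refine ⟨fun i => if i ∈ σ then (σ.card : ℝ)⁻¹ else 0, ⟨fun i => ?_, ?_⟩, ?_⟩
  · dsimp only
    split_ifs <;> positivity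
  · simp [hcard.ne']
  · ext i
    by_cases hi : i ∈ σ <;> simp [mem_posSupport, hi, hcard]

theorem mem_affineSpan_of_posSupport_subset [AddCommGroup W] [Module ℝ W] {φ : ι → W}
    {σ : Finset ι} {μ : ι → ℝ} (hμ : μ ∈ stdSimplex ℝ ι) (hσ : posSupport μ ⊆ σ) :
    Fintype.linearCombination ℝ φ μ ∈ affineSpan ℝ (φ '' σ) := by
  have hzero (i) (hi : i ∉ posSupport μ) : μ i = 0 :=
    le_antisymm (not_lt.1 fun h => hi (mem_posSupport.2 h)) (hμ.1 i)
  rw [Fintype.linearCombination_apply, ← Finset.sum_subset (Finset.subset_univ (posSupport μ))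
    fun i _ hi => by rw [hzero i hi, zero_smul]]
  refine convexHull_subset_affineSpan _ ((convex_convexHull ℝ _).sum_mem (fun i _ => hμ.1 i) ?_
    fun i hi => subset_convexHull ℝ _ ⟨i, hσ hi, rfl⟩)
  rw [← hμ.2]
  exact Finset.sum_subset (Finset.subset_univ _) fun i _ hi => hzero i hi

/-- A triangulation of `P` with vertices `φ i`: the set `K` of faces is an abstract simplicial
complex on the index type, and every point of `P` has unique barycentric coordinates that are
supported on a face. Disjointness of the relative interiors of the simplices and their affine
independence are both encoded in the uniqueness. -/
structure IsTriangulation [AddCommGroup W] [Module ℝ W] (φ : ι → W) (K : Set (Finset ι))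
    (P : Set W) : Prop where
  isLowerSet : IsLowerSet K
  mem : ∀ μ ∈ stdSimplex ℝ ι, posSupport μ ∈ K → Fintype.linearCombination ℝ φ μ ∈ P
  existsUnique : ∀ x ∈ P, ∃! μ, μ ∈ stdSimplex ℝ ι ∧ posSupport μ ∈ K ∧
    Fintype.linearCombination ℝ φ μ = x

namespace IsTriangulation

variable [AddCommGroup W] [Module ℝ W] {φ : ι → W} {K : Set (Finset ι)} {P : Set W}
  {σ : Finset ι}

theorem eq_of_linearCombination_eq (h : IsTriangulation φ K P) {μ ν : ι → ℝ} (hμ0 : 0 ≤ μ)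
    (hν0 : 0 ≤ ν) (hμK : posSupport μ ∈ K) (hνK : posSupport ν ∈ K) (hsum : ∑ i, μ i = ∑ i, ν i)
    (heq : Fintype.linearCombination ℝ φ μ = Fintype.linearCombination ℝ φ ν) : μ = ν := by
  have hs : 0 ≤ ∑ i, μ i := Finset.sum_nonneg fun i _ => hμ0 i
  rcases hs.eq_or_lt with hs | hs
  · have hμ := (Fintype.sum_eq_zero_iff_of_nonneg hμ0).1 hs.symm
    have hν := (Fintype.sum_eq_zero_iff_of_nonneg hν0).1 (hsum.symm.trans hs.symm)
    rw [hμ, hν]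
  · have hinv := inv_pos.2 hs
    have hsupp (κ : ι → ℝ) : posSupport ((∑ i, μ i)⁻¹ • κ) = posSupport κ := by
      ext i
      simp [mem_posSupport, hs]
    have hmem {κ : ι → ℝ} (hκ : 0 ≤ κ) (hκs : ∑ i, κ i = ∑ i, μ i) :
        (∑ i, μ i)⁻¹ • κ ∈ stdSimplex ℝ ι := by
      refine ⟨fun i => mul_nonneg hinv.le (hκ i), ?_⟩
      simp only [Pi.smul_apply, smul_eq_mul, ← Finset.mul_sum, hκs, inv_mul_cancel₀ hs.ne']
    have hμ := hmem hμ0 rfl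
    have hν := hmem hν0 hsum.symm
    have hμK' := (hsupp μ).symm ▸ hμK
    refine smul_right_injective _ hinv.ne' ((h.existsUnique _ (h.mem _ hμ hμK')).unique
      ⟨hμ, hμK', rfl⟩ ⟨hν, (hsupp ν).symm ▸ hνK, ?_⟩)
    rw [map_smul, map_smul, heq]

theorem eq_zero_of_linearCombination_eq_zero (h : IsTriangulation φ K P) (hσ : σ ∈ K)
    {w : ι → ℝ} (hwσ : ∀ i, w i ≠ 0 → i ∈ σ) (hsum : ∑ i, w i = 0)
    (hw : Fintype.linearCombination ℝ φ w = 0) : w = 0 := by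
  have hsub : w⁺ - w⁻ = w := posPart_sub_negPart w
  have hpos : posSupport w⁺ ⊆ σ := fun i hi => hwσ i fun h0 => by
    simp [mem_posSupport, h0] at hi
  have hneg : posSupport w⁻ ⊆ σ := fun i hi => hwσ i fun h0 => by
    simp [mem_posSupport, h0] at hi
  rw [← hsub, h.eq_of_linearCombination_eq (posPart_nonneg w) (negPart_nonneg w)
    (h.isLowerSet hpos hσ) (h.isLowerSet hneg hσ) ?_ ?_, sub_self]
  · rw [← sub_eq_zero, ← Finset.sum_sub_distrib, ← hsum]
    exact Finset.sum_congr rfl fun i _ => congrFun hsub i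
  · rw [← sub_eq_zero, ← map_sub, hsub, hw]

theorem affineIndependent (h : IsTriangulation φ K P) (hσ : σ ∈ K) :
    AffineIndependent ℝ fun i : σ => φ i := by
  rw [affineIndependent_iff_of_fintype]
  intro w hsum hw i
  rw [Finset.weightedVSub_eq_linear_combination _ hsum] at hw
  let v : ι → ℝ := Function.extend Subtype.val w 0
  have hv (j : σ) : v j = w j := Subtype.val_injective.extend_apply w 0 j
  have hv0 (j) (hj : j ∉ Set.range (Subtype.val : σ → ι)) : v j = 0 :=
    Function.extend_apply' _ _ _ hj
  have hvzero : v = 0 := by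
    refine h.eq_zero_of_linearCombination_eq_zero hσ (fun j hj => ?_) ?_ ?_
    · by_contra hjσ
      exact hj (hv0 j (by simpa using hjσ))
    · rw [← hsum]
      exact (Fintype.sum_of_injective _ Subtype.val_injective _ _ hv0 fun j => (hv j).symm).symm
    · rw [← hw, Fintype.linearCombination_apply]
      refine (Fintype.sum_of_injective _ Subtype.val_injective _ _ (fun j hj => ?_)
        fun j => ?_).symm
      · rw [hv0 j hj, zero_smul]
      · rw [hv]
  rw [← hv, hvzero, Pi.zero_apply]

theorem apply_mem (h : IsTriangulation φ K P) (hσ : σ ∈ K) {i : ι} (hi : i ∈ σ) : φ i ∈ P := by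
  have hsupp : posSupport (Pi.single i (1 : ℝ)) ⊆ σ := fun j hj => by
    rcases eq_or_ne j i with rfl | hji
    · exact hi
    · simp [mem_posSupport, hji] at hj
  simpa using h.mem _ (single_mem_stdSimplex ℝ i) (h.isLowerSet hsupp hσ)

variable [TopologicalSpace W] [IsTopologicalAddGroup W] [ContinuousSMul ℝ W] [T2Space W]

theorem eventually_posSupport_eq (h : IsTriangulation φ K P) (hσ : Maximal (· ∈ K) σ)
    {μ : ι → ℝ} (hμ : μ ∈ stdSimplex ℝ ι) (hμσ : posSupport μ = σ) :
    ∀ᶠ x in nhds (Fintype.linearCombination ℝ φ μ), ∀ ν ∈ stdSimplex ℝ ι, posSupport ν ∈ K →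
      Fintype.linearCombination ℝ φ ν = x → posSupport ν = σ := by
  have hlower : IsLowerSet (K \ {σ}) := fun τ υ hυτ hτ =>
    ⟨h.isLowerSet hυτ hτ.1, fun hυ => hτ.2 (hσ.eq_of_ge hτ.1 (hυ ▸ hυτ))⟩
  have hcont : Continuous (Fintype.linearCombination ℝ φ) := LinearMap.continuous_on_pi _
  have hclosed := (((isCompact_stdSimplex ℝ ι).inter_right
    (isClosed_setOf_posSupport_mem hlower)).image hcont).isClosed
  refine Filter.mem_of_superset (hclosed.isOpen_compl.mem_nhds ?_) fun x hx ν hν hνK hνx => ?_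
  · rintro ⟨ν, ⟨hν, hνK⟩, hνμ⟩
    have hμK : posSupport μ ∈ K := hμσ ▸ hσ.prop
    obtain rfl := (h.existsUnique _ (h.mem μ hμ hμK)).unique ⟨hν, hνK.1, hνμ⟩ ⟨hμ, hμK, rfl⟩
    exact hνK.2 hμσ
  · by_contra hne
    exact hx ⟨ν, ⟨hν, hνK, hne⟩, hνx⟩

theorem subset_affineSpan (h : IsTriangulation φ K P) (hP : Convex ℝ P)
    (hσ : Maximal (· ∈ K) σ) (hne : σ.Nonempty) : P ⊆ affineSpan ℝ (φ '' σ) := by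
  intro y hy
  obtain ⟨μ, hμ, hμσ⟩ := exists_mem_stdSimplex_posSupport_eq hne
  set x := Fintype.linearCombination ℝ φ μ
  have hxP : x ∈ P := h.mem μ hμ (hμσ ▸ hσ.prop)
  have hlim : Filter.Tendsto (AffineMap.lineMap x y) (nhdsWithin (0 : ℝ) (Set.Ioi 0)) (nhds x) :=
    tendsto_nhdsWithin_of_tendsto_nhds
      ((AffineMap.lineMap_continuous (R := ℝ)).tendsto' 0 x (AffineMap.lineMap_apply_zero x y))
  obtain ⟨ε, hε, hε0, hε1⟩ := ((hlim.eventually (h.eventually_posSupport_eq hσ hμ hμσ)).and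
    (Ioo_mem_nhdsGT (zero_lt_one' ℝ))).exists
  obtain ⟨ν, ⟨hν, hνK, hνε⟩, -⟩ :=
    h.existsUnique _ (hP.lineMap_mem hxP hy ⟨hε0.le, hε1.le⟩)
  have hxspan : x ∈ affineSpan ℝ (φ '' σ) := mem_affineSpan_of_posSupport_subset hμ hμσ.le
  have hεspan : AffineMap.lineMap x y ε ∈ affineSpan ℝ (φ '' σ) :=
    hνε ▸ mem_affineSpan_of_posSupport_subset hν (hε ν hν hνK hνε).le
  simpa [hε0.ne'] using AffineMap.lineMap_mem ε⁻¹ hxspan hεspan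

end IsTriangulation

theorem IsTriangulation.card_of_maximal {E : Type*} {φ : ι → E → ℝ} {K : Set (Finset ι)}
    {P : Set (E → ℝ)} {σ : Finset ι} (h : IsTriangulation φ K P) (hP : Convex ℝ P)
    (hσ : Maximal (· ∈ K) σ) : (σ.card : ℤ) = polytopeDim P + 1 := by
  rcases σ.eq_empty_or_nonempty with rfl | hne
  · have hempty : P = ∅ := by
      refine Set.eq_empty_iff_forall_notMem.2 fun x hx => ?_
      obtain ⟨μ, ⟨hμ, hμK, -⟩, -⟩ := h.existsUnique x hx
      have hμ0 : posSupport μ = ∅ := (hσ.eq_of_le hμK (Finset.empty_subset _)).symm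
      have hle : ∑ i, μ i ≤ 0 := Finset.sum_nonpos fun i _ =>
        not_lt.1 fun hi => by simpa [hμ0] using mem_posSupport.2 hi
      exact absurd hμ.2 (by linarith)
    simp [polytopeDim, hempty]
  · obtain ⟨i, hi⟩ := id hne
    have : Nonempty σ := ⟨⟨i, hi⟩⟩
    have hspan : affineSpan ℝ P = affineSpan ℝ (φ '' σ) :=
      le_antisymm (affineSpan_le.2 (h.subset_affineSpan hP hσ hne))
        (affineSpan_mono ℝ (Set.image_subset_iff.2 fun j hj => h.apply_mem hσ.prop hj))
    have hcard := (h.affineIndependent hσ.prop).finrank_vectorSpan_add_one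
    rw [polytopeDim, if_neg (Set.Nonempty.ne_empty ⟨_, h.apply_mem hσ.prop hi⟩),
      ← direction_affineSpan, hspan, direction_affineSpan, Set.image_eq_range,
      ← Fintype.card_coe σ]
    exact_mod_cast hcard.symm

end Triangulation

section LayeringTriangulation

variable {V E : Type*} {G : DirGraph V E} {b : V → ℤ} {F : FramingData V E}

/-- The total flow out of the vertex `i` minus the total flow into `i`, as a linear function of the
flow on the edges. -/
noncomputable def DirGraph.netOutflow [Fintype E] (G : DirGraph V E) (i : V) :
    (E → ℝ) →ₗ[ℝ] ℝ :=
  ∑ e with G.tail e = i, LinearMap.proj e - ∑ e with G.head e = i, LinearMap.proj e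

theorem DirGraph.netOutflow_apply [Fintype E] (G : DirGraph V E) (i : V) (f : E → ℝ) :
    G.netOutflow i f = ∑ e with G.tail e = i, f e - ∑ e with G.head e = i, f e := by
  simp [netOutflow]

theorem DirGraph.mem_flowPolytope [Fintype E] {f : E → ℝ} :
    f ∈ G.flowPolytope b ↔ (∀ e, 0 ≤ f e) ∧ ∀ i, G.netOutflow i f = b i := by
  simp only [flowPolytope, Set.mem_ofPred_eq, netOutflow_apply]

theorem DirGraph.convex_flowPolytope [Fintype E] (G : DirGraph V E) (b : V → ℤ) :
    Convex ℝ (G.flowPolytope b) := by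
  intro x hx y hy s t hs ht hst
  rw [mem_flowPolytope] at hx hy ⊢
  refine ⟨fun e => add_nonneg (mul_nonneg hs (hx.1 e)) (mul_nonneg ht (hy.1 e)), fun i => ?_⟩
  rw [map_add, map_smul, map_smul, hx.2, hy.2, ← add_smul, hst, one_smul]

theorem DirGraph.IsPath.netOutflow_count [Fintype E] {u v : V} {p : List E}
    (h : G.IsPath u p v) (i : V) : G.netOutflow i (fun e => (p.count e : ℝ)) =
      (if u = i then 1 else 0) - (if v = i then 1 else 0) := by
  induction p generalizing u with
  | nil =>
    obtain rfl : u = v := h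
    simp [netOutflow_apply]
  | cons e p ih =>
    obtain ⟨rfl, h⟩ := h
    have hcount : (fun g => ((e :: p).count g : ℝ)) =
        (fun g => (p.count g : ℝ)) + fun g => if e = g then 1 else 0 := by
      funext g
      simp [List.count_cons]
    rw [hcount, map_add, ih h, netOutflow_apply]
    simp

theorem netOutflow_routeFlow [Fintype E] [Fintype G.Route] (c : G.Route → ℝ) (i : V) :
    G.netOutflow i (routeFlow G c) =
      ∑ P with P.start = i, c P - ∑ P with P.finish = i, c P := by
  simp only [routeFlow, Fintype.linearCombination_apply, map_sum, map_smul,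
    DirGraph.IsPath.netOutflow_count (DirGraph.Route.isPath _), Finset.sum_filter, smul_eq_mul,
    mul_sub, mul_ite, mul_one, mul_zero, Finset.sum_sub_distrib]

theorem HasMarginals.routeFlow_mem_flowPolytope [Fintype E] [Fintype G.Route]
    (hb : IsUnitSupply G b) {c : G.Route → ℝ} (h : HasMarginals b 1 c) (hc : ∀ P, 0 ≤ c P) :
    routeFlow G c ∈ G.flowPolytope b := by
  refine DirGraph.mem_flowPolytope.2 ⟨fun e => ?_, fun i => ?_⟩
  · rw [routeFlow_apply]
    exact Finset.sum_nonneg fun P _ => nsmul_nonneg (hc P) _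
  rw [netOutflow_routeFlow]
  have hstart (hs : ¬ G.IsSource i) : ∑ P : G.Route with P.start = i, c P = 0 :=
    Finset.sum_eq_zero fun P hP => absurd ((Finset.mem_filter.1 hP).2 ▸ P.start_isSource) hs
  have hfinish (hv : ¬ G.IsSink i) : ∑ P : G.Route with P.finish = i, c P = 0 :=
    Finset.sum_eq_zero fun P hP => absurd ((Finset.mem_filter.1 hP).2 ▸ P.finish_isSink) hv
  by_cases hs : G.IsSource i <;> by_cases hv : G.IsSink i
  · have hbi : b i = 0 := (hb.source i hs).resolve_right fun h1 => by simpa [h1] using hb.sink i hv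
    simp [h.start i hs, h.finish i hv, hbi]
  · simp [h.start i hs, hfinish hv]
  · simp [hstart hs, h.finish i hv]
  · simp [hstart hs, hfinish hv, hb.internal i ⟨hs, hv⟩]

/-- The flow that sends a unit along each route of `L`; for a layering `L`, these are the vertices
of the triangulation of the flow polytope. -/
noncomputable def layeringFlow [Fintype G.Route] (L : Finset G.Route) : E → ℝ :=
  routeFlow G (layerSum G (Pi.single L 1))

theorem linearCombination_layeringFlow [Fintype G.Route] :
    Fintype.linearCombination ℝ layeringFlow = routeFlow G ∘ₗ layerSum G := by
  ext L : 2
  simp [layeringFlow]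

theorem isTriangulation_layeringFlow [Finite V] [Fintype E] [Fintype G.Route] (hG : G.Acyclic)
    (hb : IsUnitSupply G b) (hF : IsFramed G b F) (hb0 : b ≠ 0) :
    IsTriangulation layeringFlow {𝓛 | IsLayeringSimplex G b F 𝓛} (G.flowPolytope b) := by
  have hO := hF.totalOrderOn_layeringLt hb
  have hmarg {μ : Finset G.Route → ℝ} (hμ : 0 ≤ μ) (h : IsLayeringSimplex G b F (posSupport μ)) :
      HasMarginals b (∑ L, μ L) (layerSum G μ) :=
    hasMarginals_layerSum hb fun L hL => h.layering L (mem_posSupport.2 ((hμ L).lt_of_ne' hL))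
  have hclique {μ : Finset G.Route → ℝ} (hμ : μ ∈ stdSimplex ℝ (Finset G.Route))
      (h : IsLayeringSimplex G b F (posSupport μ)) :
      IsCliqueDecomposition b F (routeFlow G (layerSum G μ)) (layerSum G μ) :=
    ⟨layerSum_nonneg hμ.1, fun P hP Q hQ =>
      h.clique P ((layerSum_pos_iff hμ.1).1 hP) Q ((layerSum_pos_iff hμ.1).1 hQ), rfl,
      hμ.2 ▸ hmarg hμ.1 h⟩
  refine ⟨fun 𝓛 𝓜 hs h => h.subset hs, fun μ hμ h => ?_, fun f hf => ?_⟩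
  · rw [linearCombination_layeringFlow]
    exact (hclique hμ h).marginals.routeFlow_mem_flowPolytope hb (layerSum_nonneg hμ.1)
  · simp only [linearCombination_layeringFlow, LinearMap.comp_apply]
    obtain ⟨c, hc⟩ := exists_isCliqueDecomposition hG hb hF hf
    obtain ⟨μ, hμ0, hμ, rfl⟩ := hc.marginals.exists_layerSum_eq hb hO hc.nonneg hc.clique
    have hμ1 : ∑ L, μ L = 1 := (hmarg hμ0 hμ).eq_of_ne_zero hb hb0 hc.marginals
    refine ⟨μ, ⟨⟨hμ0, hμ1⟩, hμ, hc.flow⟩, fun ν ⟨hν1, hν, hνf⟩ => ?_⟩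
    exact hν.eq_of_layerSum_eq hO hν1.1 hμ0 hμ
      ((hνf ▸ hclique hν1 hν).unique hG hF hc)

theorem card_of_maximal_isLayeringSimplex [Finite V] [Fintype E] (hG : G.Acyclic)
    (hb : IsUnitSupply G b) (hF : IsFramed G b F) (hb0 : b ≠ 0) {𝓛 : Finset (Finset G.Route)}
    (h𝓛 : Maximal (IsLayeringSimplex G b F) 𝓛) :
    (𝓛.card : ℤ) = polytopeDim (G.flowPolytope b) + 1 := by
  have := DirGraph.Route.finite hG
  have := Fintype.ofFinite G.Route
  exact (isTriangulation_layeringFlow hG hb hF hb0).card_of_maximal (G.convex_flowPolytope b) h𝓛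

end LayeringTriangulation

section Augmentations

theorem polytopeDim_image {E E' : Type*} {f : (E → ℝ) →ᵃ[ℝ] (E' → ℝ)} (hf : Function.Injective f)
    (P : Set (E → ℝ)) : polytopeDim (f '' P) = polytopeDim P := by
  rw [polytopeDim, polytopeDim, ← f.map_vectorSpan,
    ← (Submodule.equivMapOfInjective f.linear (f.linear_injective_iff.2 hf) _).finrank_eq]
  simp only [Set.image_eq_empty]

variable {V E : Type*} {G : DirGraph V E} {a : V → ℤ}

theorem DirGraph.IsConservationist.isUnitSupply (h : G.IsConservationist a) :
    IsUnitSupply G a where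
  source i hi := Or.inr (h.source i hi)
  sink i hi := (h.sink i hi).le
  internal := h.internal

theorem IsConsFraming.isFramed {F : FramingData V E} (h : IsConsFraming G F) :
    IsFramed G a F where
  out i := by
    by_cases hi : G.IsSink i
    · exact TotalOrderOn.of_subsingleton fun e he => absurd he (hi e)
    · exact (h.out i hi).ne_and
  inc i hi := by
    by_cases hs : G.IsSource i
    · exact TotalOrderOn.of_subsingleton fun e he => absurd he (hs e)
    · exact (h.inc i ⟨hs, hi⟩).ne_and
  src := h.src.mono fun _ hs => hs.1

namespace Augmentation

variable {X Y EX EY : Type*} [Fintype EX] [Fintype EY] (A : Augmentation G a X Y EX EY)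

theorem isSource_inflow (x : X) : A.graph.IsSource (.inr (.inl x)) := by
  rintro (e | x' | y) <;> simp [graph]

theorem isSink_outflow (y : Y) : A.graph.IsSink (.inr (.inr y)) := by
  rintro (e | x | y') <;> simp [graph]

theorem exists_isPath_of_isPath_inl {i j : V} {p : List (E ⊕ EX ⊕ EY)}
    (h : A.graph.IsPath (.inl i) p (.inl j)) :
    ∃ q : List E, p = q.map Sum.inl ∧ G.IsPath i q j := by
  induction p generalizing i with
  | nil => exact ⟨[], rfl, Sum.inl_injective h⟩
  | cons e p ih =>
    obtain ⟨he, h⟩ := h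
    rcases e with e | x | y
    · obtain ⟨q, rfl, hq⟩ := ih h
      exact ⟨e :: q, rfl, Sum.inl_injective he, hq⟩
    · cases he
    · obtain rfl := h.eq_nil_of_isSink (A.isSink_outflow _)
      cases h

theorem acyclic_graph (hG : G.Acyclic) : A.graph.Acyclic := by
  rintro (i | x | y) p h
  · obtain ⟨q, rfl, hq⟩ := A.exists_isPath_of_isPath_inl h
    rw [hG i q hq, List.map_nil]
  · exact h.eq_nil_of_isSource (A.isSource_inflow x)
  · exact h.eq_nil_of_isSink (A.isSink_outflow y)

theorem isUnitSupply : IsUnitSupply A.graph A.netflow where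
  source := by
    rintro (i | x | y) hi
    · exact Or.inl rfl
    · exact Or.inr rfl
    · obtain ⟨e, rfl⟩ := A.yHead_bijective.surjective y
      exact absurd rfl (hi (.inr (.inr e)))
  sink := by
    rintro (i | x | y) hi
    · exact le_rfl
    · obtain ⟨e, rfl⟩ := A.xTail_bijective.surjective x
      exact absurd rfl (hi (.inr (.inl e)))
    · exact (A.yNetflow_neg y).le
  internal := by
    rintro (i | x | y) hi
    · rfl
    · exact absurd (A.isSource_inflow x) hi.1
    · exact absurd (A.isSink_outflow y) hi.2

variable {A} in
theorem IsFraming.isFramed {F : FramingData (V ⊕ X ⊕ Y) (E ⊕ EX ⊕ EY)} (h : A.IsFraming F) :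
    IsFramed A.graph A.netflow F where
  out := by
    rintro (i | x | y)
    · exact (h.out i).ne_and
    · obtain ⟨x, rfl⟩ := A.xTail_bijective.surjective x
      refine TotalOrderOn.of_subsingleton (Set.subsingleton_of_subset_singleton
        (a := .inr (.inl x)) ?_)
      rintro (e | x' | y) he
      · cases he
      · exact congrArg (Sum.inr ∘ Sum.inl) (A.xTail_bijective.injective
          (Sum.inl_injective (Sum.inr_injective he)))
      · cases he
    · exact TotalOrderOn.of_subsingleton fun e he => absurd he (A.isSink_outflow y e)
  inc := by
    rintro (i | x | y) hi
    · exact (h.inc i).ne_and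
    · exact TotalOrderOn.of_subsingleton fun e he => absurd he (A.isSource_inflow x e)
    · exact absurd (A.isSink_outflow y) hi
  src := by
    refine h.src.mono ?_
    rintro (i | x | y) ⟨-, hi⟩
    · exact absurd hi (zero_ne_one' ℤ)
    · exact ⟨x, rfl⟩
    · have hy : A.yNetflow y = 1 := hi
      exact absurd (hy ▸ A.yNetflow_neg y) (by decide)

theorem netflow_eq_card_inflow_add_sum_outflow (i : V) :
    a i = (Finset.univ.filter (A.xHead · = i)).card +
      ∑ y with A.yTail y = i, A.yNetflow (A.yHead y) := by
  have hx (h : a i ≤ 0) : Finset.univ.filter (A.xHead · = i) = ∅ :=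
    Finset.filter_eq_empty_iff.2 fun x _ hx => (A.xHead_pos x).not_ge (hx ▸ h)
  have hy (h : 0 ≤ a i) : Finset.univ.filter (A.yTail · = i) = ∅ :=
    Finset.filter_eq_empty_iff.2 fun y _ hy => (A.yTail_neg y).not_ge (hy ▸ h)
  rcases lt_trichotomy (a i) 0 with h | h | h
  · rw [hx h.le, Finset.card_empty, Nat.cast_zero, zero_add]
    exact A.sum_yNetflow i h
  · rw [hx h.le, hy h.ge, h, Finset.card_empty, Finset.sum_empty, Nat.cast_zero, add_zero]
  · rw [hy h.le, Finset.sum_empty, add_zero, ← A.card_inflow i h, Nat.card_eq_fintype_card,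
      Fintype.card_subtype]

theorem netflow_ne_zero (ha : a ≠ 0) : A.netflow ≠ 0 := by
  intro h0
  have hx (x : EX) : (1 : ℤ) = 0 := congrFun h0 (.inr (.inl (A.xTail x)))
  have hy (y : EY) : A.yNetflow (A.yHead y) = 0 := congrFun h0 (.inr (.inr (A.yHead y)))
  refine ha (funext fun i => ?_)
  rw [A.netflow_eq_card_inflow_add_sum_outflow i, Finset.sum_eq_zero fun y _ => hy y, add_zero,
    Finset.filter_eq_empty_iff.2 fun x _ _ => one_ne_zero (hx x), Finset.card_empty, Nat.cast_zero,
    Pi.zero_apply]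

/-- The extension of a function on the old edges to the augmented graph by the values that the
netflow forces every flow to take on the new edges. -/
noncomputable def extendFlow : (E → ℝ) →ᵃ[ℝ] (E ⊕ EX ⊕ EY → ℝ) :=
  AffineMap.pi fun
    | .inl e => (LinearMap.proj e).toAffineMap
    | .inr (.inl _) => AffineMap.const ℝ _ 1
    | .inr (.inr y) => AffineMap.const ℝ _ (-A.yNetflow (A.yHead y))

theorem extendFlow_apply (f : E → ℝ) :
    A.extendFlow f = Sum.elim f (Sum.elim 1 fun y => -A.yNetflow (A.yHead y)) := by
  funext e
  rcases e with e | x | y <;> rfl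

theorem extendFlow_injective : Function.Injective A.extendFlow := fun f g h => by
  rw [extendFlow_apply, extendFlow_apply] at h
  exact funext fun e => congrFun h (.inl e)

variable [Fintype E]

theorem netOutflow_extendFlow (f : E → ℝ) (i : V) :
    A.graph.netOutflow (.inl i) (A.extendFlow f) = G.netOutflow i f - a i := by
  rw [A.netflow_eq_card_inflow_add_sum_outflow i]
  simp only [extendFlow_apply, DirGraph.netOutflow_apply, Finset.sum_filter,
    Fintype.sum_sum_type, graph, Sum.elim_inl, Sum.elim_inr, Pi.one_apply, Sum.inl.injEq,
    reduceCtorEq, if_false, Finset.sum_const_zero, Finset.sum_boole]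
  simp only [← Finset.sum_filter, Finset.sum_neg_distrib]
  push_cast
  ring

theorem netOutflow_inflow (f : E ⊕ EX ⊕ EY → ℝ) (x : EX) :
    A.graph.netOutflow (.inr (.inl (A.xTail x))) f = f (.inr (.inl x)) := by
  simp [DirGraph.netOutflow_apply, Finset.sum_filter, graph, A.xTail_bijective.injective.eq_iff]

theorem netOutflow_outflow (f : E ⊕ EX ⊕ EY → ℝ) (y : EY) :
    A.graph.netOutflow (.inr (.inr (A.yHead y))) f = -f (.inr (.inr y)) := by
  simp [DirGraph.netOutflow_apply, Finset.sum_filter, graph, A.yHead_bijective.injective.eq_iff]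

theorem extendFlow_comp_inl {f : E ⊕ EX ⊕ EY → ℝ} (hf : f ∈ A.graph.flowPolytope A.netflow) :
    A.extendFlow (f ∘ Sum.inl) = f := by
  have hnet := (DirGraph.mem_flowPolytope.1 hf).2
  rw [extendFlow_apply]
  funext e
  rcases e with e | x | y
  · rfl
  · simpa [netflow, eq_comm] using (A.netOutflow_inflow f x).symm.trans (hnet _)
  · simpa [netflow, neg_eq_iff_eq_neg, eq_comm] using
      (A.netOutflow_outflow f y).symm.trans (hnet _)

theorem extendFlow_mem_flowPolytope_iff {f : E → ℝ} :
    A.extendFlow f ∈ A.graph.flowPolytope A.netflow ↔ f ∈ G.flowPolytope a := by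
  have hy (y : EY) : (A.yNetflow (A.yHead y) : ℝ) ≤ 0 := Int.cast_nonpos.2 (A.yNetflow_neg _).le
  have hinflow (x : X) : A.graph.netOutflow (.inr (.inl x)) (A.extendFlow f) = 1 := by
    obtain ⟨x, rfl⟩ := A.xTail_bijective.surjective x
    simp [A.netOutflow_inflow, extendFlow_apply]
  have houtflow (y : Y) :
      A.graph.netOutflow (.inr (.inr y)) (A.extendFlow f) = A.yNetflow y := by
    obtain ⟨y, rfl⟩ := A.yHead_bijective.surjective y
    simp [A.netOutflow_outflow, extendFlow_apply]
  simp only [DirGraph.mem_flowPolytope, Sum.forall, A.netOutflow_extendFlow, hinflow, houtflow]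
  simp [extendFlow_apply, netflow, sub_eq_zero, hy]

theorem flowPolytope_graph :
    A.graph.flowPolytope A.netflow = A.extendFlow '' G.flowPolytope a := by
  refine Set.Subset.antisymm (fun f hf => ?_)
    (Set.image_subset_iff.2 fun f hf => A.extendFlow_mem_flowPolytope_iff.2 hf)
  have hext := A.extendFlow_comp_inl hf
  exact ⟨f ∘ Sum.inl, A.extendFlow_mem_flowPolytope_iff.1 (hext.symm ▸ hf), hext⟩

theorem polytopeDim_graph :
    polytopeDim (A.graph.flowPolytope A.netflow) = polytopeDim (G.flowPolytope a) := by
  rw [A.flowPolytope_graph, polytopeDim_image A.extendFlow_injective]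

end Augmentation

end Augmentations

end FramedFlow

theorem corollary4p7 {V E : Type*} [Fintype V] [Fintype E]
    (G : FramedFlow.DirGraph V E) (hG : G.Acyclic) (a : V → ℤ) (ha : a ≠ 0) :
    (∀ {X Y EX EY : Type*} [Fintype X] [Fintype Y] [Fintype EX] [Fintype EY]
        (A : FramedFlow.Augmentation G a X Y EX EY)
        (F : FramedFlow.FramingData (V ⊕ X ⊕ Y) (E ⊕ EX ⊕ EY)), A.IsFraming F →
        ∀ 𝓛 : Finset (Finset A.graph.Route),
          Maximal (FramedFlow.IsLayeringSimplex A.graph A.netflow F) 𝓛 →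
          (𝓛.card : ℤ) = FramedFlow.polytopeDim (G.flowPolytope a) + 1) ∧
    (∀ F : FramedFlow.FramingData V E, G.IsConservationist a → FramedFlow.IsConsFraming G F →
        ∀ 𝓛 : Finset (Finset G.Route),
          Maximal (FramedFlow.IsLayeringSimplex G a F) 𝓛 →
          (𝓛.card : ℤ) = FramedFlow.polytopeDim (G.flowPolytope a) + 1) := by
  refine ⟨fun A F hF 𝓛 h𝓛 => ?_, fun F hcons hF 𝓛 h𝓛 => ?_⟩
  · rw [← A.polytopeDim_graph]
    exact FramedFlow.card_of_maximal_isLayeringSimplex (A.acyclic_graph hG) A.isUnitSupply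
      hF.isFramed (A.netflow_ne_zero ha) h𝓛
  · exact FramedFlow.card_of_maximal_isLayeringSimplex hG hcons.isUnitSupply hF.isFramed ha h𝓛
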